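/- **Theorem.** Let $\triangle$ be the infinite triangular grid, i.e. the projection $\varphi$ of the cubic grid $\mathbb{Z}^3$ along the direction $(1,1,1)$, so that $\varphi(x,y,z)=\varphi(x+k,y+k,z+k)$. Its edges join each vertex $v$ to $v+\varphi(1,0,0)$, $v+\varphi(0,1,0)$ and $v+\varphi(0,0,1)$. A *calisson* is the union of two triangles of $\triangle$ that share an edge, or equivalently the projection of a square face of the cubic grid; its colour is the normal direction of that face, so there are three colours. For a finite set $X$ of edges of $\triangle$, a *solution* of the puzzle $\mathrm{Calissons}(X,\triangle)$ is a tiling of the whole grid $\triangle$ by calissons such that (i) no edge of $X$ is overlapped by the interior of a calisson, and (ii) the two calissons adjacent to any edge of $X$ have different colours. There is an algorithm that, given any finite set $X$ of edges of $\triangle$ (as a list of its edges without repetition, in integer homogeneous coordinates), decides in $O(|X|^3)$ steps whether $\mathrm{Calissons}(X,\triangle)$ has a solution. Here an algorithm is a program of a deterministic random access machine on integers, where each addition, subtraction, comparison, direct or indirect memory access and test costs one step; the bound means at most $K(|X|^3+1)$ steps, with a constant $K$ that depends on neither $X$ nor the list. -/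

import Mathlib

namespace Calissons

/-! ### The triangular grid and its calissons -/

/-- The vertices of the cubic grid. -/
abbrev Point : Type := Fin 3 → ℤ

/-- The vertices of the infinite triangular grid: the points `φ(x,y,z)`, where `φ` is the projection
of the cubic grid in the direction `(1,1,1)`, so that `φ(x,y,z) = φ(x+k,y+k,z+k)`. -/
abbrev Vertex : Type := Point ⧸ AddSubgroup.zmultiples (1 : Point)

/-- The projection `φ` on vertices. -/
def proj (p : Point) : Vertex := QuotientAddGroup.mk p

/-- The step `φ(1,0,0)`, `φ(0,1,0)` or `φ(0,0,1)` of the triangular grid. -/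
def dir (i : Fin 3) : Vertex := proj (Pi.single i 1)

/-- The edges of the triangular grid: pairs of vertices that differ by one of the three steps. -/
def gridEdges : Set (Sym2 Vertex) := {e | ∃ v i, e = s(v, v + dir i)}

/-- The triangles of the grid, each given by its set of three corners. As the three steps add up to
zero, `i ≠ j` makes the last corner adjacent to the first one. -/
def gridTriangles : Set (Set Vertex) :=
  {t | ∃ v i j, i ≠ j ∧ t = {v, v + dir i, v + dir i + dir j}}

/-- A calisson is the projection of a square face of the cubic grid. It is determined by the
projection `base` of the lowest corner of that face and by the normal direction of the face, which is
its colour (`0`: blue, `1`: red, `2`: yellow). The sides of the calisson have the two other directions,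
`color + 1` and `color + 2` modulo `3`. -/
structure Calisson where
  base : Vertex
  color : Fin 3

namespace Calisson

/-- The two triangles that form a calisson. -/
def triangles (c : Calisson) : Set (Set Vertex) :=
  {{c.base, c.base + dir (c.color + 1), c.base + dir (c.color + 1) + dir (c.color + 2)},
   {c.base, c.base + dir (c.color + 2), c.base + dir (c.color + 2) + dir (c.color + 1)}}

/-- The four sides of a calisson. -/
def sides (c : Calisson) : Set (Sym2 Vertex) :=
  {s(c.base, c.base + dir (c.color + 1)),
   s(c.base, c.base + dir (c.color + 2)),
   s(c.base + dir (c.color + 1), c.base + dir (c.color + 1) + dir (c.color + 2)),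
   s(c.base + dir (c.color + 2), c.base + dir (c.color + 1) + dir (c.color + 2))}

/-- The common edge of the two triangles of a calisson: the only edge of the grid that is overlapped
by the interior of the calisson. -/
def diagonal (c : Calisson) : Sym2 Vertex :=
  s(c.base, c.base + dir (c.color + 1) + dir (c.color + 2))

end Calisson

/-- A calisson tiling of the whole triangular grid. -/
def IsTiling (T : Set Calisson) : Prop :=
  ∀ t ∈ gridTriangles, ∃! c, c ∈ T ∧ t ∈ c.triangles

/-- No edge of `X` is overlapped by the interior of a calisson. -/
def NonOverlap (X : Set (Sym2 Vertex)) (T : Set Calisson) : Prop :=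
  ∀ e ∈ X, ∀ c ∈ T, c.diagonal ≠ e

/-- The two calissons adjacent to an edge of `X` have different colours. -/
def Salient (X : Set (Sym2 Vertex)) (T : Set Calisson) : Prop :=
  ∀ e ∈ X, ∀ c ∈ T, ∀ c' ∈ T, c ≠ c' → e ∈ c.sides → e ∈ c'.sides → c.color ≠ c'.color

/-- The calissons puzzle on the whole grid, with the edges `X`, has a solution. -/
def HasSolution (X : Set (Sym2 Vertex)) : Prop :=
  ∃ T : Set Calisson, IsTiling T ∧ NonOverlap X T ∧ Salient X T

/-! ### Random access machines with unit cost -/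

/-- A state of the machine: registers, which a program addresses by fixed numbers, and a random access
memory, which it addresses by computed values. -/
@[ext] structure State where
  reg : ℕ → ℤ
  mem : ℤ → ℤ

namespace State

/-- Write the value `z` into register `r`. -/
def setReg (s : State) (r : ℕ) (z : ℤ) : State := { s with reg := Function.update s.reg r z }

/-- Write the value `z` into the memory cell `a`. -/
def setMem (s : State) (a z : ℤ) : State := { s with mem := Function.update s.mem a z }

end State

/-- Programs. A program is a finite object and does not depend on the input. -/
inductive Program : Type
  /-- Do nothing. -/
  | skip : Program
  /-- `reg r := z` -/
  | const (r : ℕ) (z : ℤ) : Program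
  /-- `reg r := reg a + reg b` -/
  | add (r a b : ℕ) : Program
  /-- `reg r := reg a - reg b` -/
  | sub (r a b : ℕ) : Program
  /-- `reg r := mem (reg a)` -/
  | load (r a : ℕ) : Program
  /-- `mem (reg a) := reg b` -/
  | store (a b : ℕ) : Program
  /-- First `P`, then `Q`. -/
  | seq (P Q : Program) : Program
  /-- If `0 < reg r` then `P`, else `Q`. -/
  | branch (r : ℕ) (P Q : Program) : Program
  /-- As long as `0 < reg r`, do `P`. -/
  | loop (r : ℕ) (P : Program) : Program

/-- `Exec P s t s'`: started in the state `s`, the program `P` halts in the state `s'` after exactly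
`t` steps. Every elementary instruction and every test costs one step. -/
inductive Exec : Program → State → ℕ → State → Prop
  | skip (s : State) : Exec .skip s 1 s
  | const (s : State) (r : ℕ) (z : ℤ) : Exec (.const r z) s 1 (s.setReg r z)
  | add (s : State) (r a b : ℕ) : Exec (.add r a b) s 1 (s.setReg r (s.reg a + s.reg b))
  | sub (s : State) (r a b : ℕ) : Exec (.sub r a b) s 1 (s.setReg r (s.reg a - s.reg b))
  | load (s : State) (r a : ℕ) : Exec (.load r a) s 1 (s.setReg r (s.mem (s.reg a)))
  | store (s : State) (a b : ℕ) : Exec (.store a b) s 1 (s.setMem (s.reg a) (s.reg b))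
  | seq {P Q : Program} {s s' s'' : State} {t t' : ℕ} :
      Exec P s t s' → Exec Q s' t' s'' → Exec (.seq P Q) s (t + t') s''
  | branch_pos {r : ℕ} {P Q : Program} {s s' : State} {t : ℕ} :
      0 < s.reg r → Exec P s t s' → Exec (.branch r P Q) s (t + 1) s'
  | branch_neg {r : ℕ} {P Q : Program} {s s' : State} {t : ℕ} :
      ¬ 0 < s.reg r → Exec Q s t s' → Exec (.branch r P Q) s (t + 1) s'
  | loop_pos {r : ℕ} {P : Program} {s s' s'' : State} {t t' : ℕ} :
      0 < s.reg r → Exec P s t s' → Exec (.loop r P) s' t' s'' → Exec (.loop r P) s (t + t' + 1) s''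
  | loop_neg {r : ℕ} {P : Program} {s : State} :
      ¬ 0 < s.reg r → Exec (.loop r P) s 1 s

/-- The machine is deterministic: the final state and the number of steps are unique. -/
theorem Exec.unique {P : Program} {s s₁ s₂ : State} {t₁ t₂ : ℕ}
    (h₁ : Exec P s t₁ s₁) (h₂ : Exec P s t₂ s₂) : t₁ = t₂ ∧ s₁ = s₂ := by
  induction h₁ generalizing t₂ s₂ with
  | seq _ _ ih ih' =>
    cases h₂ with
    | seq a b =>
      obtain ⟨rfl, rfl⟩ := ih a
      obtain ⟨rfl, rfl⟩ := ih' b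
      exact ⟨rfl, rfl⟩
  | branch_pos h _ ih =>
    cases h₂ with
    | branch_pos _ a => obtain ⟨rfl, rfl⟩ := ih a; exact ⟨rfl, rfl⟩
    | branch_neg h' _ => exact absurd h h'
  | branch_neg h _ ih =>
    cases h₂ with
    | branch_pos h' _ => exact absurd h' h
    | branch_neg _ a => obtain ⟨rfl, rfl⟩ := ih a; exact ⟨rfl, rfl⟩
  | loop_pos h _ _ ih ih' =>
    cases h₂ with
    | loop_pos _ a b =>
      obtain ⟨rfl, rfl⟩ := ih a
      obtain ⟨rfl, rfl⟩ := ih' b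
      exact ⟨rfl, rfl⟩
    | loop_neg h' => exact absurd h h'
  | loop_neg h =>
    cases h₂ with
    | loop_pos h' _ _ => exact absurd h' h
    | loop_neg _ => exact ⟨rfl, rfl⟩
  | _ => cases h₂; exact ⟨rfl, rfl⟩

/-! ### Instances as inputs of the machine -/

/-- A code of an edge: homogeneous coordinates of its origin, and its direction. -/
structure EdgeCode where
  origin : Point
  direction : Fin 3

namespace EdgeCode

/-- The edge with a given code. -/
def edge (w : EdgeCode) : Sym2 Vertex := s(proj w.origin, proj w.origin + dir w.direction)

/-- The four integers of a code. -/
def toInts (w : EdgeCode) : List ℤ :=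
  [w.origin 0, w.origin 1, w.origin 2, ((w.direction : ℕ) : ℤ)]

end EdgeCode

/-- The list `l` of codes enumerates the finite set `X` of edges without repetition. -/
def Enumerates (l : List EdgeCode) (X : Finset (Sym2 Vertex)) : Prop :=
  (l.map EdgeCode.edge).Nodup ∧ ∀ e, e ∈ X ↔ e ∈ l.map EdgeCode.edge

/-- The initial state on the input `l`: register `0` holds the number of edges, the memory cells
`0, 1, 2, …` hold the codes one after the other, and everything else is `0`. -/
def inputState (l : List EdgeCode) : State where
  reg r := if r = 0 then (l.length : ℤ) else 0
  mem a := if 0 ≤ a then (l.flatMap EdgeCode.toInts).getD a.toNat 0 else 0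

end Calissons

/-!
The proof turns the puzzle into a system of difference constraints of linear size and solves it with
the Bellman–Ford method.

*Heights.* In a calisson tiling every triangle has exactly one side that is the diagonal of a
calisson. Hence the indicator of the diagonals is a closed form, and by a discrete Poincaré lemma it
is the increment of a function `g` on the cubic grid that is monotone and satisfies
`g (p + 1) = g p + 1`; conversely every such `g` comes from a tiling (`exists_height_of_isTiling`,
`exists_isTiling_of_height`). With `p` the origin and `i` the direction of an edge, and `j`, `k` the
two other directions, the first condition of the puzzle says `g (p + unit i) = g p`, and, given this,
the second one says `g (p - unit j) = g (p - unit k)` (`salient_iff`). So each edge of the puzzle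
involves four points, which carry two unknown heights.

*Constraints.* Values on finitely many points extend to a height on the whole grid if and only if
`g q ≥ g p + m` for any two of the points, where `m` is the smallest coordinate of `q - p`; the
extension is the least one, a maximum over the given points (`exists_height_of_siteArcs`). For `n`
edges this is a system of `(4 * n) ^ 2` difference constraints in at most `2 * n` unknowns.

*Bellman–Ford.* If such a system is satisfiable, then relaxing all constraints, in any order and from
any initial values, stops changing the values after as many rounds as there are unknowns, because a
longer chain of raises would run through a cycle of positive weight. If the values stop changing,
they satisfy the system (`bellmanFord_flag`). With `16 * n` rounds of `(4 * n) ^ 2` relaxations in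
constant time, this takes `O(n ^ 3)` steps.

*The machine.* The program `Program.solver` writes the points as records of four cells at negative
addresses and keeps the unknowns in the cells of the input. Its parts without loops are
evaluated symbolically (`RunsIn.eval`), its loops by induction on the list that they run through, and
the registers that a part does not mention are preserved (`Exec.reg_eq`).
-/

namespace Calissons

/-! ### Systems of difference constraints -/

/-- A difference constraint: the value at `tgt` exceeds the value at `src` by at least `weight`. -/
structure Arc (α : Type*) where
  src : α
  tgt : α
  weight : ℤ

/-- The values `e` satisfy the constraint `c`. -/
def Arc.Holds {α : Type*} (c : Arc α) (e : α → ℤ) : Prop := e c.src + c.weight ≤ e c.tgt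

/-- One step of the Bellman–Ford method: the value at the target is raised if the constraint is
violated. The second component is a flag that records that some value has been raised. -/
def relax {α : Type*} [DecidableEq α] (st : (α → ℤ) × ℤ) (c : Arc α) : (α → ℤ) × ℤ :=
  if st.1 c.tgt < st.1 c.src + c.weight then
    (Function.update st.1 c.tgt (st.1 c.src + c.weight), 1)
  else st

/-- One round of the Bellman–Ford method, which starts with the flag cleared. -/
def bellmanFordRound {α : Type*} [DecidableEq α] (A : List (Arc α)) (st : (α → ℤ) × ℤ) :
    (α → ℤ) × ℤ :=
  A.foldl relax (st.1, 0)

/-- A value that is still raised by the simultaneous relaxation number `k` was raised at the end of a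
walk along which the values have been raised one after the other. -/
theorem exists_walk_of_lt {α : Type*} {A : List (Arc α)} {D : ℕ → α → ℤ}
    (hA : ∀ k, ∀ c ∈ A, D k c.src + c.weight ≤ D (k + 1) c.tgt)
    (hj : ∀ k j, D (k + 1) j = D k j ∨ ∃ c ∈ A, c.tgt = j ∧ D (k + 1) j = D k c.src + c.weight)
    (k : ℕ) (j : α) (h : D k j < D (k + 1) j) :
    ∃ p : ℕ → α, p (k + 1) = j ∧ ∀ l ≤ k, D l (p (l + 1)) < D (l + 1) (p (l + 1)) ∧
      ∃ c ∈ A, c.src = p l ∧ c.tgt = p (l + 1) ∧ D (l + 1) (p (l + 1)) = D l (p l) + c.weight := by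
  induction k generalizing j with
  | zero =>
    rcases hj 0 j with h' | ⟨c, hc, rfl, h'⟩
    · omega
    · refine ⟨fun l => if l = 0 then c.src else c.tgt, by simp, fun l hl => ?_⟩
      obtain rfl : l = 0 := by omega
      exact ⟨by simpa using h, c, hc, by simp, by simp, by simpa using h'⟩
  | succ k ih =>
    rcases hj (k + 1) j with h' | ⟨c, hc, rfl, h'⟩
    · omega
    · have hlt : D k c.src < D (k + 1) c.src := by
        have := hA k c hc
        omega
      obtain ⟨p, hp, hw⟩ := ih c.src hlt
      refine ⟨Function.update p (k + 2) c.tgt, by simp, fun l hl => ?_⟩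
      rcases Nat.lt_or_ge k l with hkl | hkl
      · obtain rfl : l = k + 1 := by omega
        have e1 : Function.update p (k + 2) c.tgt (k + 1 + 1) = c.tgt := by simp
        have e2 : Function.update p (k + 2) c.tgt (k + 1) = c.src := by simp [hp]
        rw [e1, e2]
        exact ⟨h, c, hc, rfl, rfl, h'⟩
      · have e1 : Function.update p (k + 2) c.tgt (l + 1) = p (l + 1) :=
          Function.update_of_ne (by omega) _ _
        have e2 : Function.update p (k + 2) c.tgt l = p l :=
          Function.update_of_ne (by omega) _ _
        rw [e1, e2]
        exact hw l hkl

/-- If the constraints are satisfiable, then the simultaneous relaxation is stationary after as many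
steps as there are nodes: a longer walk of raises would run through a cycle of positive weight. -/
theorem simultaneous_relax_stationary {α : Type*} {A : List (Arc α)} {D : ℕ → α → ℤ}
    (hA : ∀ k, ∀ c ∈ A, D k c.src + c.weight ≤ D (k + 1) c.tgt)
    (hD : ∀ k, D k ≤ D (k + 1))
    (hj : ∀ k j, D (k + 1) j = D k j ∨ ∃ c ∈ A, c.tgt = j ∧ D (k + 1) j = D k c.src + c.weight)
    {S : Finset α} (hS : ∀ c ∈ A, c.src ∈ S) {u : α → ℤ} (hu : ∀ c ∈ A, c.Holds u)
    {k : ℕ} (hk : S.card ≤ k) : D (k + 1) = D k := by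
  by_contra hne
  obtain ⟨j, hlt⟩ : ∃ j, D k j < D (k + 1) j := by
    by_contra! h
    exact hne (le_antisymm h (hD k))
  obtain ⟨p, -, hp⟩ := exists_walk_of_lt hA hj k j hlt
  have hmaps : ∀ a ∈ Finset.range (k + 1), p a ∈ S := by
    intro a ha
    obtain ⟨-, c, hc, h1, -⟩ := hp a (by simpa [Nat.lt_succ_iff] using ha)
    exact h1 ▸ hS c hc
  obtain ⟨a, ha, b, hb, hab, heq⟩ := Finset.exists_ne_map_eq_of_card_lt_of_maps_to
    (s := Finset.range (k + 1)) (t := S) (by simpa using Nat.lt_succ_of_le hk) hmaps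
  rw [Finset.mem_range] at ha hb
  have key : ∀ a b, a < b → b < k + 1 → p a = p b → False := by
    intro a b hab hb heq
    -- along the walk the surplus over the solution `u` does not grow
    have mono : ∀ d, a + d ≤ k → D (a + d) (p (a + d)) - u (p (a + d)) ≤ D a (p a) - u (p a) := by
      intro d
      induction d with
      | zero => exact fun _ => le_rfl
      | succ d ih =>
        intro h
        have h1 := ih (by omega)
        obtain ⟨-, c, hc, hs, ht, hv⟩ := hp (a + d) (by omega)
        have h2 : u c.src + c.weight ≤ u c.tgt := hu c hc
        rw [hs, ht] at h2
        change D (a + d + 1) (p (a + d + 1)) - u (p (a + d + 1)) ≤ _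
        omega
    obtain ⟨d, rfl⟩ : ∃ d, b = a + d + 1 := ⟨b - a - 1, by omega⟩
    have h1 := mono (d + 1) (by omega)
    rw [← add_assoc, ← heq] at h1
    have h2 := (hp (a + d) (by omega)).1
    rw [← heq] at h2
    have h3 : D a (p a) ≤ D (a + d) (p a) := monotone_nat_of_le_succ hD (Nat.le_add_right a d) _
    omega
  rcases lt_or_gt_of_ne hab with h | h
  · exact key a b h hb heq
  · exact key b a h ha heq.symm

section BellmanFord

variable {α : Type*} [DecidableEq α]

theorem relax_fst_of_ne {st : (α → ℤ) × ℤ} {c : Arc α} {j : α} (h : j ≠ c.tgt) :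
    (relax st c).1 j = st.1 j := by
  unfold relax
  split_ifs
  · exact Function.update_of_ne h _ _
  · rfl

theorem foldl_relax_fst_of_ne {A : List (Arc α)} {st : (α → ℤ) × ℤ} {j : α}
    (h : ∀ c ∈ A, j ≠ c.tgt) : (A.foldl relax st).1 j = st.1 j := by
  induction A generalizing st with
  | nil => rfl
  | cons c A ih =>
    rw [List.foldl_cons, ih fun d hd => h d (List.mem_cons_of_mem _ hd),
      relax_fst_of_ne (h c List.mem_cons_self)]

theorem le_relax (st : (α → ℤ) × ℤ) (c : Arc α) : st.1 ≤ (relax st c).1 := by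
  unfold relax
  split_ifs with h
  · exact le_update_iff.2 ⟨h.le, fun _ _ => le_rfl⟩
  · exact le_rfl

theorem le_foldl_relax (A : List (Arc α)) (st : (α → ℤ) × ℤ) : st.1 ≤ (A.foldl relax st).1 := by
  induction A generalizing st with
  | nil => exact le_rfl
  | cons c A ih => exact (le_relax st c).trans (ih _)

theorem src_add_weight_le_foldl_relax {A : List (Arc α)} {c : Arc α} (hc : c ∈ A)
    (st : (α → ℤ) × ℤ) : st.1 c.src + c.weight ≤ (A.foldl relax st).1 c.tgt := by
  induction A generalizing st with
  | nil => simp at hc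
  | cons d A ih =>
    rcases List.mem_cons.1 hc with rfl | hc
    · refine le_trans ?_ (le_foldl_relax A (relax st c) c.tgt)
      unfold relax
      split_ifs with h
      · simp
      · exact not_lt.1 h
    · exact le_trans (by simpa using le_relax st d c.src) (ih hc (relax st d))

theorem foldl_relax_le {A : List (Arc α)} {u : α → ℤ} (hu : ∀ c ∈ A, c.Holds u)
    {st : (α → ℤ) × ℤ} (h : st.1 ≤ u) : (A.foldl relax st).1 ≤ u := by
  induction A generalizing st with
  | nil => exact h
  | cons c A ih =>
    refine ih (fun d hd => hu d (List.mem_cons_of_mem _ hd)) ?_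
    have hc := hu c List.mem_cons_self
    unfold relax
    split_ifs
    · refine update_le_iff.2 ⟨?_, fun _ _ => h _⟩
      have : st.1 c.src ≤ u c.src := h c.src
      unfold Arc.Holds at hc
      omega
    · exact h

theorem foldl_relax_of_holds {A : List (Arc α)} {st : (α → ℤ) × ℤ} (h : ∀ c ∈ A, c.Holds st.1) :
    A.foldl relax st = st := by
  induction A with
  | nil => rfl
  | cons c A ih =>
    have : relax st c = st := if_neg (not_lt.2 (h c List.mem_cons_self))
    rw [List.foldl_cons, this]
    exact ih fun d hd => h d (List.mem_cons_of_mem _ hd)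

theorem foldl_relax_snd (A : List (Arc α)) (st : (α → ℤ) × ℤ) :
    (A.foldl relax st).2 = 1 ∨ ∀ c ∈ A, c.Holds st.1 := by
  induction A generalizing st with
  | nil => simp
  | cons c A ih =>
    by_cases hc : st.1 c.tgt < st.1 c.src + c.weight
    · left
      have key : ∀ (B : List (Arc α)) (st : (α → ℤ) × ℤ), st.2 = 1 → (B.foldl relax st).2 = 1 := by
        intro B
        induction B with
        | nil => exact fun _ h => h
        | cons d B ihB =>
          intro st h
          refine ihB _ ?_
          unfold relax
          split_ifs
          · rfl
          · exact h
      exact key A _ (by simp [relax, hc])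
    · have : relax st c = st := if_neg hc
      rw [List.foldl_cons, this]
      refine (ih st).imp_right fun h d hd => ?_
      rcases List.mem_cons.1 hd with rfl | hd
      · exact not_lt.1 hc
      · exact h d hd

/-- A simultaneous relaxation of all constraints. In contrast to `bellmanFordRound`, new values are
computed from old values only. -/
theorem exists_simultaneous_relax (A : List (Arc α)) (e : α → ℤ) :
    ∃ e' : α → ℤ, e ≤ e' ∧ (∀ c ∈ A, e c.src + c.weight ≤ e' c.tgt) ∧
      ∀ j, e' j = e j ∨ ∃ c ∈ A, c.tgt = j ∧ e' j = e c.src + c.weight := by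
  induction A with
  | nil => exact ⟨e, le_rfl, by simp, fun j => Or.inl rfl⟩
  | cons c A ih =>
    obtain ⟨e', h1, h2, h3⟩ := ih
    refine ⟨Function.update e' c.tgt (max (e' c.tgt) (e c.src + c.weight)), ?_, ?_, ?_⟩
    · exact h1.trans (le_update_iff.2 ⟨le_max_left _ _, fun _ _ => le_rfl⟩)
    · intro d hd
      rcases List.mem_cons.1 hd with rfl | hd
      · simp
      · refine (h2 d hd).trans ?_
        exact (le_update_iff.2 ⟨le_max_left _ _, fun _ _ => le_rfl⟩ :
          e' ≤ Function.update e' c.tgt (max (e' c.tgt) (e c.src + c.weight))) d.tgt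
    · intro j
      have old : e' j = e j ∨ ∃ d ∈ c :: A, d.tgt = j ∧ e' j = e d.src + d.weight :=
        (h3 j).imp_right fun ⟨d, hd, h⟩ => ⟨d, List.mem_cons_of_mem _ hd, h⟩
      by_cases hj : j = c.tgt
      · subst hj
        rw [Function.update_self]
        rcases max_choice (e' c.tgt) (e c.src + c.weight) with h | h
        · rw [h]; exact old
        · exact Or.inr ⟨c, List.mem_cons_self, rfl, h⟩
      · rw [Function.update_of_ne hj]; exact old

/-- If the constraints are satisfiable, then they hold after as many rounds of the Bellman–Ford
method as there are nodes, whatever the values at the beginning. The values are squeezed between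
those of the simultaneous relaxation and its limit. -/
theorem holds_iterate_bellmanFordRound {A : List (Arc α)} {S : Finset α} (hS : ∀ c ∈ A, c.src ∈ S)
    {u : α → ℤ} (hu : ∀ c ∈ A, c.Holds u) {k : ℕ} (hk : S.card ≤ k) (st : (α → ℤ) × ℤ) :
    ∀ c ∈ A, c.Holds ((bellmanFordRound A)^[k] st).1 := by
  choose F hF1 hF2 hF3 using exists_simultaneous_relax A
  set D : ℕ → α → ℤ := fun k => F^[k] st.1 with hDdef
  have hDs : ∀ k, D (k + 1) = F (D k) := fun k => Function.iterate_succ_apply' F k st.1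
  have stat : D (k + 1) = D k :=
    simultaneous_relax_stationary (A := A) (by simpa [hDs] using fun k => hF2 (D k))
      (by simpa [hDs] using fun k => hF1 (D k)) (by simpa [hDs] using fun k => hF3 (D k)) hS hu hk
  have hlim : ∀ c ∈ A, c.Holds (D k) := by
    intro c hc
    have := hF2 (D k) c hc
    rwa [← hDs, stat] at this
  have low : ∀ m, D m ≤ ((bellmanFordRound A)^[m] st).1 := by
    intro m
    induction m with
    | zero => exact le_rfl
    | succ m ih =>
      rw [Function.iterate_succ_apply', hDs]
      intro j
      rcases hF3 (D m) j with h | ⟨c, hc, rfl, h⟩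
      · rw [h]
        exact (ih j).trans (le_foldl_relax A (((bellmanFordRound A)^[m] st).1, 0) j)
      · rw [h]
        exact le_trans (by simpa using ih c.src)
          (src_add_weight_le_foldl_relax hc (((bellmanFordRound A)^[m] st).1, 0))
  have high : ∀ m, ((bellmanFordRound A)^[m] st).1 ≤ D k := by
    intro m
    induction m with
    | zero =>
      exact (monotone_nat_of_le_succ (f := D) (fun n => by rw [hDs]; exact hF1 _)
        (Nat.zero_le k) :)
    | succ m ih =>
      rw [Function.iterate_succ_apply']
      exact foldl_relax_le hlim ih
  rw [le_antisymm (high k) (low k)]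
  exact hlim

/-- After more rounds than there are nodes, the flag tells whether the constraints are
satisfiable. -/
theorem bellmanFord_flag {A : List (Arc α)} {S : Finset α} (hS : ∀ c ∈ A, c.src ∈ S) {k : ℕ}
    (hk : S.card < k) (st : (α → ℤ) × ℤ) :
    ((∃ u : α → ℤ, ∀ c ∈ A, c.Holds u) → ((bellmanFordRound A)^[k] st).2 = 0) ∧
      ((¬ ∃ u : α → ℤ, ∀ c ∈ A, c.Holds u) → ((bellmanFordRound A)^[k] st).2 = 1) := by
  obtain ⟨k, rfl⟩ : ∃ m, k = m + 1 := ⟨k - 1, by omega⟩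
  rw [Function.iterate_succ_apply']
  constructor
  · rintro ⟨u, hu⟩
    have h := holds_iterate_bellmanFordRound hS hu (Nat.le_of_lt_succ hk) st
    exact congrArg Prod.snd (foldl_relax_of_holds (st := (((bellmanFordRound A)^[k] st).1, 0)) h)
  · intro hn
    refine (foldl_relax_snd A (((bellmanFordRound A)^[k] st).1, 0)).resolve_right fun h => ?_
    exact hn ⟨_, h⟩

end BellmanFord

/-! ### Coordinates on the triangular grid -/

/-- The unit vector of `Point` in the direction `i`. -/
abbrev unit (i : Fin 3) : Point := Pi.single i 1

theorem proj_eq_proj_iff {p q : Point} :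
    proj p = proj q ↔ p 0 - q 0 = p 2 - q 2 ∧ p 1 - q 1 = p 2 - q 2 := by
  unfold proj
  rw [QuotientAddGroup.eq, AddSubgroup.mem_zmultiples_iff]
  constructor
  · rintro ⟨k, hk⟩
    have h := fun i => congrFun hk i
    simp only [Pi.smul_apply, Pi.one_apply, Pi.add_apply, Pi.neg_apply, smul_eq_mul, mul_one] at h
    have h0 := h 0
    have h1 := h 1
    have h2 := h 2
    omega
  · rintro ⟨h0, h1⟩
    refine ⟨q 2 - p 2, funext fun i => ?_⟩
    fin_cases i <;> simp <;> omega

theorem proj_add_dir (p : Point) (i : Fin 3) : proj p + dir i = proj (p + unit i) := rfl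

theorem proj_surjective : Function.Surjective proj := QuotientAddGroup.mk_surjective

theorem eq_zero_one_two : ∀ i : Fin 3, i = 0 ∨ i = 1 ∨ i = 2 := by decide

theorem cases_of_distinct : ∀ i j k : Fin 3, i ≠ j → j ≠ k → k ≠ i →
    i = 0 ∧ j = 1 ∧ k = 2 ∨ i = 0 ∧ j = 2 ∧ k = 1 ∨ i = 1 ∧ j = 0 ∧ k = 2 ∨
    i = 1 ∧ j = 2 ∧ k = 0 ∨ i = 2 ∧ j = 0 ∧ k = 1 ∨ i = 2 ∧ j = 1 ∧ k = 0 := by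
  intro i j k
  fin_cases i <;> fin_cases j <;> fin_cases k <;> simp

theorem proj_eq_proj_of_distinct {p q : Point} {i j k : Fin 3} (hij : i ≠ j) (hjk : j ≠ k)
    (hki : k ≠ i) : proj p = proj q ↔ p i - q i = p k - q k ∧ p j - q j = p k - q k := by
  rw [proj_eq_proj_iff]
  rcases cases_of_distinct i j k hij hjk hki with ⟨rfl, rfl, rfl⟩ | ⟨rfl, rfl, rfl⟩ |
    ⟨rfl, rfl, rfl⟩ | ⟨rfl, rfl, rfl⟩ | ⟨rfl, rfl, rfl⟩ | ⟨rfl, rfl, rfl⟩ <;> omega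

theorem unit_add_unit_add_unit {i j k : Fin 3} (hij : i ≠ j) (hjk : j ≠ k) (hki : k ≠ i) :
    unit i + unit j + unit k = 1 := by
  funext l
  revert i j k l
  decide

theorem dir_add_dir_add_dir {i j k : Fin 3} (hij : i ≠ j) (hjk : j ≠ k) (hki : k ≠ i) :
    dir i + dir j + dir k = 0 := by
  have : dir i + dir j + dir k = proj (unit i + unit j + unit k) := rfl
  rw [this, unit_add_unit_add_unit hij hjk hki]
  exact (QuotientAddGroup.eq_zero_iff _).2 (AddSubgroup.mem_zmultiples _)

theorem add_one_add_two_of_distinct {i j k : Fin 3} (hij : i ≠ j) (hjk : j ≠ k) (hki : k ≠ i) :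
    i + 1 = j ∧ i + 2 = k ∨ i + 1 = k ∧ i + 2 = j := by
  revert i j k; decide

/-- A triangle belongs to the three calissons whose diagonal is one of its three sides. -/
theorem triangle_mem_triangles_iff (v : Vertex) {i j k : Fin 3} (hij : i ≠ j) (hjk : j ≠ k)
    (hki : k ≠ i) (c : Calisson) :
    {v, v + dir i, v + dir i + dir j} ∈ c.triangles ↔
      c = ⟨v + dir i, i⟩ ∨ c = ⟨v + dir i + dir j, j⟩ ∨ c = ⟨v, k⟩ := by
  constructor
  · intro h
    obtain ⟨p, rfl⟩ := proj_surjective v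
    obtain ⟨b, m⟩ := c
    obtain ⟨q, rfl⟩ := proj_surjective b
    simp only [Calisson.triangles, Set.mem_insert_iff, Set.mem_singleton_iff, proj_add_dir,
      Calisson.mk.injEq] at h ⊢
    have key : ∀ a b c a' b' c' : Vertex, ({a, b, c} : Set Vertex) = {a', b', c'} →
        (a = a' ∨ a = b' ∨ a = c') ∧ (b = a' ∨ b = b' ∨ b = c') ∧ (c = a' ∨ c = b' ∨ c = c') := by
      intro a b c a' b' c' h
      have h1 : a ∈ ({a', b', c'} : Set Vertex) := h ▸ (by simp)
      have h2 : b ∈ ({a', b', c'} : Set Vertex) := h ▸ (by simp)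
      have h3 : c ∈ ({a', b', c'} : Set Vertex) := h ▸ (by simp)
      exact ⟨h1, h2, h3⟩
    have h' := h.imp (key _ _ _ _ _ _) (key _ _ _ _ _ _)
    clear h key
    revert h'
    have hm : m = i ∨ m = j ∨ m = k := by clear * - hij hjk hki; revert i j k m; decide
    simp only [proj_eq_proj_of_distinct hij hjk hki, Pi.add_apply]
    rcases hm with rfl | rfl | rfl
    · rcases add_one_add_two_of_distinct hij hjk hki with ⟨h1, h2⟩ | ⟨h1, h2⟩ <;> rw [h1, h2] <;>
        simp [hij, hij.symm, hjk, hjk.symm, hki, hki.symm] <;> omega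
    · rcases add_one_add_two_of_distinct hjk hki hij with ⟨h1, h2⟩ | ⟨h1, h2⟩ <;> rw [h1, h2] <;>
        simp [hij, hij.symm, hjk, hjk.symm, hki, hki.symm] <;> omega
    · rcases add_one_add_two_of_distinct hki hij hjk with ⟨h1, h2⟩ | ⟨h1, h2⟩ <;> rw [h1, h2] <;>
        simp [hij, hij.symm, hjk.symm, hki] <;> omega
  · have rot : ∀ a b c : Vertex, ({a, b, c} : Set Vertex) = {b, c, a} := by
      intro a b c; ext x; simp; tauto
    have hs := dir_add_dir_add_dir hij hjk hki
    have hor : ∀ w : Vertex, ∀ i j k : Fin 3, i ≠ j → j ≠ k → k ≠ i →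
        {w, w + dir i, w + dir i + dir j} ∈ Calisson.triangles ⟨w, k⟩ := by
      intro w i j k hij hjk hki
      have : k + 1 = i ∧ k + 2 = j ∨ k + 1 = j ∧ k + 2 = i := by revert i j k; decide
      rcases this with ⟨rfl, rfl⟩ | ⟨rfl, rfl⟩
      · exact Or.inl rfl
      · exact Or.inr rfl
    rintro (rfl | rfl | rfl)
    · have := hor (v + dir i) j k i hjk hki hij
      rwa [add_assoc v, add_assoc v, hs, add_zero, ← rot, ← add_assoc] at this
    · have := hor (v + dir i + dir j) k i j hki hij hjk
      rwa [add_assoc v, add_assoc v, hs, add_zero, rot, ← add_assoc] at this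
    · exact hor v i j k hij hjk hki

theorem diagonal_eq_iff (v : Vertex) (i : Fin 3) (c : Calisson) :
    c.diagonal = s(v, v + dir i) ↔ c = ⟨v + dir i, i⟩ := by
  obtain ⟨p, rfl⟩ := proj_surjective v
  obtain ⟨b, m⟩ := c
  obtain ⟨q, rfl⟩ := proj_surjective b
  simp only [Calisson.diagonal, Sym2.eq_iff, proj_add_dir, Calisson.mk.injEq, proj_eq_proj_iff,
    Pi.add_apply]
  rcases eq_zero_one_two i with rfl | rfl | rfl <;> rcases eq_zero_one_two m with rfl | rfl | rfl <;>
    simp <;> omega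

/-- The four calissons that have a given edge as a side, grouped by their colour. -/
theorem edge_mem_sides_iff (v : Vertex) {i j k : Fin 3} (hij : i ≠ j) (hjk : j ≠ k)
    (hki : k ≠ i) (c : Calisson) :
    s(v, v + dir i) ∈ c.sides ↔
      (c = ⟨v, j⟩ ∨ c = ⟨v + dir i + dir j, j⟩) ∨ (c = ⟨v, k⟩ ∨ c = ⟨v + dir i + dir k, k⟩) := by
  obtain ⟨p, rfl⟩ := proj_surjective v
  obtain ⟨b, m⟩ := c
  obtain ⟨q, rfl⟩ := proj_surjective b
  simp only [Calisson.sides, Set.mem_insert_iff, Set.mem_singleton_iff, Sym2.eq_iff, proj_add_dir,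
    Calisson.mk.injEq, proj_eq_proj_of_distinct hij hjk hki, Pi.add_apply]
  have hm : m = i ∨ m = j ∨ m = k := by clear * - hij hjk hki; revert i j k m; decide
  rcases hm with rfl | rfl | rfl
  · rcases add_one_add_two_of_distinct hij hjk hki with ⟨h1, h2⟩ | ⟨h1, h2⟩ <;> rw [h1, h2] <;>
      simp [hij, hij.symm, hjk, hjk.symm, hki, hki.symm] <;> omega
  · rcases add_one_add_two_of_distinct hjk hki hij with ⟨h1, h2⟩ | ⟨h1, h2⟩ <;> rw [h1, h2] <;>
      simp [hij, hij.symm, hjk, hjk.symm, hki, hki.symm] <;> omega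
  · rcases add_one_add_two_of_distinct hki hij hjk with ⟨h1, h2⟩ | ⟨h1, h2⟩ <;> rw [h1, h2] <;>
      simp [hij, hij.symm, hjk, hjk.symm, hki, hki.symm] <;> omega

/-! ### Tilings and heights -/

/-- A function on the cubic grid that is monotone and commutes with the translation by `(1,1,1)`.
The points `p - g p • (1,1,1)` then form a stepped surface, the lift of a calisson tiling. -/
structure IsHeight (g : Point → ℤ) : Prop where
  add_one : ∀ p, g (p + 1) = g p + 1
  mono : Monotone g

theorem IsHeight.add_zsmul_one {g : Point → ℤ} (hg : IsHeight g) (k : ℤ) (p : Point) :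
    g (p + k • 1) = g p + k := by
  induction k using Int.induction_on with
  | zero => simp
  | succ k ih => rw [add_smul, ← add_assoc, one_smul, hg.add_one, ih, add_assoc]
  | pred k ih =>
    have h := hg.add_one (p + (-(k : ℤ) - 1) • 1)
    have e : p + (-(k : ℤ) - 1) • 1 + 1 = p + (-(k : ℤ)) • (1 : Point) := by
      rw [sub_smul, one_smul]; abel
    rw [e, ih] at h
    omega

open Classical in
/-- Tells whether the edge from `proj p` in the direction `i` is the diagonal of a calisson
of `T`. -/
noncomputable def overlap (T : Set Calisson) (p : Point) (i : Fin 3) : ℤ :=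
  if ⟨proj p + dir i, i⟩ ∈ T then 1 else 0

theorem overlap_congr (T : Set Calisson) {p q : Point} (h : proj p = proj q) (i : Fin 3) :
    overlap T p i = overlap T q i := by
  unfold overlap; rw [h]

theorem overlap_eq_zero_iff {T : Set Calisson} {p : Point} {i : Fin 3} :
    overlap T p i = 0 ↔ ⟨proj p + dir i, i⟩ ∉ T := by
  unfold overlap; split_ifs with h <;> simp [h]

theorem overlap_eq_one_iff {T : Set Calisson} {p : Point} {i : Fin 3} :
    overlap T p i = 1 ↔ ⟨proj p + dir i, i⟩ ∈ T := by
  unfold overlap; split_ifs with h <;> simp [h]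

theorem overlap_eq_zero_or_one (T : Set Calisson) (p : Point) (i : Fin 3) :
    overlap T p i = 0 ∨ overlap T p i = 1 := by
  unfold overlap; split_ifs <;> simp

theorem add_units (p : Point) {i j k : Fin 3} (hij : i ≠ j) (hjk : j ≠ k) (hki : k ≠ i) :
    p + unit i + unit j + unit k = p + 1 := by
  rw [add_assoc, add_assoc, ← add_assoc (unit i), unit_add_unit_add_unit hij hjk hki]

theorem proj_add_one (p : Point) : proj (p + 1) = proj p := by
  rw [proj_eq_proj_iff]; simp

theorem add_dirs (v : Vertex) {i j k : Fin 3} (hij : i ≠ j) (hjk : j ≠ k) (hki : k ≠ i) :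
    v + dir i + dir j + dir k = v := by
  rw [add_assoc, add_assoc, ← add_assoc (dir i), dir_add_dir_add_dir hij hjk hki, add_zero]

open Classical in
theorem existsUnique_mem_iff {α : Type*} {T : Set α} {a b c : α} (hab : a ≠ b) (hbc : b ≠ c)
    (hca : c ≠ a) : (∃! x, x ∈ T ∧ (x = a ∨ x = b ∨ x = c)) ↔
      (if a ∈ T then 1 else 0) + (if b ∈ T then 1 else 0) + (if c ∈ T then 1 else 0) = (1 : ℤ) := by
  constructor
  · rintro ⟨x, ⟨hx, hx'⟩, hu⟩
    have ua : a ∈ T → a = x := fun h => hu a ⟨h, by simp⟩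
    have ub : b ∈ T → b = x := fun h => hu b ⟨h, by simp⟩
    have uc : c ∈ T → c = x := fun h => hu c ⟨h, by simp⟩
    rcases hx' with rfl | rfl | rfl
    · rw [if_pos hx, if_neg fun h => hab (ub h).symm, if_neg fun h => hca (uc h)]; rfl
    · rw [if_neg fun h => hab (ua h), if_pos hx, if_neg fun h => hbc (uc h).symm]; rfl
    · rw [if_neg fun h => hca (ua h).symm, if_neg fun h => hbc (ub h), if_pos hx]; rfl
  · intro h
    by_cases ha : a ∈ T
    · refine ⟨a, ⟨ha, Or.inl rfl⟩, ?_⟩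
      rintro x ⟨hx, rfl | rfl | rfl⟩
      · rfl
      · rw [if_pos ha, if_pos hx] at h; split_ifs at h <;> omega
      · rw [if_pos ha, if_pos hx] at h; split_ifs at h <;> omega
    · by_cases hb : b ∈ T
      · refine ⟨b, ⟨hb, Or.inr (Or.inl rfl)⟩, ?_⟩
        rintro x ⟨hx, rfl | rfl | rfl⟩
        · exact absurd hx ha
        · rfl
        · rw [if_pos hb, if_pos hx] at h; split_ifs at h; omega
      · rw [if_neg ha, if_neg hb] at h
        refine ⟨c, ⟨by by_contra hc; rw [if_neg hc] at h; omega, Or.inr (Or.inr rfl)⟩, ?_⟩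
        rintro x ⟨hx, rfl | rfl | rfl⟩
        · exact absurd hx ha
        · exact absurd hx hb
        · rfl

/-- In a tiling, exactly one side of each triangle is a diagonal. -/
theorem isTiling_iff (T : Set Calisson) :
    IsTiling T ↔ ∀ (p : Point) (i j k : Fin 3), i ≠ j → j ≠ k → k ≠ i →
      overlap T p i + overlap T (p + unit i) j + overlap T (p + unit i + unit j) k = 1 := by
  have key : ∀ (p : Point) (i j k : Fin 3), i ≠ j → j ≠ k → k ≠ i →
      ((∃! c, c ∈ T ∧ {proj p, proj p + dir i, proj p + dir i + dir j} ∈ c.triangles) ↔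
        overlap T p i + overlap T (p + unit i) j + overlap T (p + unit i + unit j) k = 1) := by
    intro p i j k hij hjk hki
    simp only [triangle_mem_triangles_iff (proj p) hij hjk hki]
    rw [existsUnique_mem_iff (fun h => hij (congrArg Calisson.color h))
      (fun h => hjk (congrArg Calisson.color h)) (fun h => hki (congrArg Calisson.color h))]
    unfold overlap
    rw [show proj (p + unit i + unit j) + dir k = proj p from add_dirs (proj p) hij hjk hki]
    exact Iff.rfl
  constructor
  · intro h p i j k hij hjk hki
    exact (key p i j k hij hjk hki).1 (h _ ⟨proj p, i, j, hij, rfl⟩)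
  · rintro h _ ⟨v, i, j, hij, rfl⟩
    obtain ⟨p, rfl⟩ := proj_surjective v
    obtain ⟨k, hjk, hki⟩ : ∃ k, j ≠ k ∧ k ≠ i := by clear * - hij; revert i j; decide
    exact (key p i j k hij hjk hki).2 (h p i j k hij hjk hki)

theorem exists_primitive (f : ℤ → ℤ) : ∃ F : ℤ → ℤ, ∀ n, F (n + 1) = F n + f n := by
  refine ⟨fun n => ∑ i ∈ Finset.range n.toNat, f i - ∑ i ∈ Finset.range (-n).toNat, f (-1 - i),
    fun n => ?_⟩
  obtain ⟨m, rfl | rfl⟩ : ∃ m : ℕ, n = m ∨ n = -1 - m := by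
    rcases le_or_gt 0 n with h | h
    · exact ⟨n.toNat, Or.inl (by omega)⟩
    · exact ⟨(-1 - n).toNat, Or.inr (by omega)⟩
  · have h1 : ((m : ℤ) + 1).toNat = m + 1 := by omega
    have h2 : (-((m : ℤ) + 1)).toNat = 0 := by omega
    have h3 : (-(m : ℤ)).toNat = 0 := by omega
    simp only [h1, h2, h3, Finset.sum_range_succ, Finset.sum_range_zero, Int.toNat_natCast]
    omega
  · have h1 : (-1 - (m : ℤ) + 1).toNat = 0 := by omega
    have h2 : (-(-1 - (m : ℤ) + 1)).toNat = m := by omega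
    have h3 : (-1 - (m : ℤ)).toNat = 0 := by omega
    have h4 : (-(-1 - (m : ℤ))).toNat = m + 1 := by omega
    simp only [h1, h2, h3, h4, Finset.sum_range_succ, Finset.sum_range_zero]
    omega

/-- A discrete Poincaré lemma in the plane. -/
theorem exists_potential (a b : ℤ → ℤ → ℤ)
    (hab : ∀ x y, a x y + b (x + 1) y = b x y + a x (y + 1)) :
    ∃ G : ℤ → ℤ → ℤ, (∀ x y, G (x + 1) y = G x y + a x y) ∧ ∀ x y, G x (y + 1) = G x y + b x y := by
  obtain ⟨F, hF⟩ := exists_primitive fun x => a x 0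
  choose B hB using fun x => exists_primitive (b x)
  refine ⟨fun x y => F x + (B x y - B x 0), fun x y => ?_, fun x y => ?_⟩
  · induction y using Int.induction_on with
    | zero => have := hF x; simp only at this ⊢; omega
    | succ y ih =>
      have h1 := hB (x + 1) y
      have h2 := hB x y
      have h3 := hab x y
      simp only at ih ⊢
      omega
    | pred y ih =>
      have h1 := hB (x + 1) (-y - 1)
      have h2 := hB x (-y - 1)
      have h3 := hab x (-y - 1)
      rw [sub_add_cancel] at h1 h2 h3
      simp only at ih ⊢
      omega
  · have := hB x y
    simp only
    omega

/-- The height is integrated in the plane of the first two coordinates and extended by the invariance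
under `(1,1,1)`. -/
theorem exists_height_of_isTiling {T : Set Calisson} (hT : IsTiling T) :
    ∃ g : Point → ℤ, IsHeight g ∧ ∀ p i, g (p + unit i) = g p + overlap T p i := by
  rw [isTiling_iff] at hT
  have h01 : (0 : Fin 3) ≠ 1 := by decide
  have h12 : (1 : Fin 3) ≠ 2 := by decide
  have h20 : (2 : Fin 3) ≠ 0 := by decide
  -- two ways along a unit square complete the same edge in the third direction to a triangle
  obtain ⟨G, hG0, hG1⟩ := exists_potential (fun x y => overlap T ![x, y, 0] 0)
    (fun x y => overlap T ![x, y, 0] 1) (by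
      intro x y
      have h := hT ![x, y, 0] 0 1 2 h01 h12 h20
      have h' := hT ![x, y, 0] 1 0 2 h01.symm h20.symm h12.symm
      have e0 : ![x, y, 0] + unit 0 = ![x + 1, y, 0] := by
        funext i; fin_cases i <;> simp
      have e1 : ![x, y, 0] + unit 1 = ![x, y + 1, 0] := by
        funext i; fin_cases i <;> simp
      rw [add_right_comm ![x, y, 0] (unit 1) (unit 0), e0, e1] at h'
      rw [e0] at h
      omega)
  have hp : ∀ p : Point, proj p = proj ![p 0 - p 2, p 1 - p 2, 0] := by
    intro p; rw [proj_eq_proj_iff]; simp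
  have step : ∀ p i, p 2 + G (p 0 - p 2) (p 1 - p 2) + overlap T p i =
      (p + unit i) 2 + G ((p + unit i) 0 - (p + unit i) 2) ((p + unit i) 1 - (p + unit i) 2) := by
    intro p i
    rcases eq_zero_one_two i with rfl | rfl | rfl
    · have := hG0 (p 0 - p 2) (p 1 - p 2)
      rw [overlap_congr T (hp p)]
      simp [add_sub_right_comm, this]
      ring
    · have := hG1 (p 0 - p 2) (p 1 - p 2)
      rw [overlap_congr T (hp p)]
      simp [add_sub_right_comm, this]
      ring
    · have h := hT (p + unit 2) 0 1 2 h01 h12 h20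
      have e1 : p + unit 2 + unit 0 + unit 1 = p + 1 := add_units p h20 h01 h12
      rw [e1, overlap_congr T (proj_add_one p), overlap_congr T (hp (p + unit 2)),
        overlap_congr T (hp (p + unit 2 + unit 0))] at h
      have a := hG0 (p 0 - (p 2 + 1)) (p 1 - (p 2 + 1))
      have b := hG1 (p 0 - (p 2 + 1) + 1) (p 1 - (p 2 + 1))
      simp at h
      simp
      have e2 : p 0 - (p 2 + 1) + 1 = p 0 - p 2 := by ring
      have e3 : p 1 - (p 2 + 1) + 1 = p 1 - p 2 := by ring
      rw [e2] at a
      rw [e2, e3] at b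
      omega
  refine ⟨fun p => p 2 + G (p 0 - p 2) (p 1 - p 2), ⟨fun p => ?_, ?_⟩, fun p i => (step p i).symm⟩
  · simp; ring
  · have le_add : ∀ (n : ℕ) (p : Point) (i : Fin 3),
        p 2 + G (p 0 - p 2) (p 1 - p 2) ≤ (fun q : Point => q 2 + G (q 0 - q 2) (q 1 - q 2))
          (p + Pi.single i (n : ℤ)) := by
      intro n p i
      induction n with
      | zero => simp
      | succ n ih =>
        refine ih.trans ?_
        have h := step (p + Pi.single i (n : ℤ)) i
        have e : p + Pi.single i ((n + 1 : ℕ) : ℤ) = p + Pi.single i (n : ℤ) + unit i := by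
          push_cast
          rw [Pi.single_add, add_assoc]
        rw [e]
        simp only at h ⊢
        rw [← h]
        rcases overlap_eq_zero_or_one T (p + Pi.single i (n : ℤ)) i with h' | h' <;> omega
    intro p q hpq
    have d := fun i => Int.toNat_of_nonneg (sub_nonneg.2 (hpq i))
    have hq : q = p + Pi.single 0 (((q 0 - p 0).toNat : ℕ) : ℤ) +
        Pi.single 1 (((q 1 - p 1).toNat : ℕ) : ℤ) + Pi.single 2 (((q 2 - p 2).toNat : ℕ) : ℤ) := by
      rw [d, d, d]
      funext i
      fin_cases i <;> simp
    rw [hq]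
    exact ((le_add _ p 0).trans (le_add _ _ 1)).trans (le_add _ _ 2)

theorem exists_isTiling_of_height {g : Point → ℤ} (hg : IsHeight g) :
    ∃ T : Set Calisson, IsTiling T ∧ ∀ p i, g (p + unit i) = g p + overlap T p i := by
  -- the increments of `g` descend to the triangular grid
  have inv : ∀ p q, proj p = proj q → ∀ u : Point, g (p + u) - g p = g (q + u) - g q := by
    intro p q h
    obtain ⟨k, rfl⟩ : ∃ k : ℤ, q = p + k • 1 := by
      rw [proj_eq_proj_iff] at h
      refine ⟨q 2 - p 2, funext fun i => ?_⟩
      fin_cases i <;> simp <;> omega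
    intro u
    rw [add_right_comm, hg.add_zsmul_one, hg.add_zsmul_one]
    omega
  have h01 : ∀ p i, g (p + unit i) = g p ∨ g (p + unit i) = g p + 1 := by
    intro p i
    have h1 : g p ≤ g (p + unit i) :=
      hg.mono (le_add_of_nonneg_right (Pi.single_nonneg.2 zero_le_one))
    have h2 : g (p + unit i) ≤ g (p + 1) := by
      refine hg.mono (add_le_add_right ?_ p)
      intro j
      by_cases h : j = i
      · subst h; simp
      · simp [h]
    have := hg.add_one p
    omega
  set T : Set Calisson := {c | ∃ p, c.base = proj p + dir c.color ∧ g (p + unit c.color) = g p + 1}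
    with hTdef
  have hT : ∀ p i, g (p + unit i) = g p + overlap T p i := by
    intro p i
    rcases h01 p i with h | h
    · have : overlap T p i = 0 := by
        rw [overlap_eq_zero_iff]
        rintro ⟨q, hq, hq'⟩
        have := inv p q (by simpa using hq) (unit i)
        simp only at hq'
        omega
      omega
    · have : overlap T p i = 1 := overlap_eq_one_iff.2 ⟨p, rfl, h⟩
      omega
  refine ⟨T, (isTiling_iff T).2 fun p i j k hij hjk hki => ?_, hT⟩
  have h1 := hT p i
  have h2 := hT (p + unit i) j
  have h3 := hT (p + unit i + unit j) k
  rw [add_units p hij hjk hki, hg.add_one] at h3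
  omega

theorem diagonal_ne_iff (T : Set Calisson) (p : Point) (i : Fin 3) :
    (∀ c ∈ T, c.diagonal ≠ s(proj p, proj p + dir i)) ↔ overlap T p i = 0 := by
  rw [overlap_eq_zero_iff]
  simp only [ne_eq, diagonal_eq_iff]
  exact ⟨fun h hc => h _ hc rfl, fun h c hc e => h (e ▸ hc)⟩

/-- If an edge is not a diagonal, then the two calissons adjacent to it have different colours if and
only if the two vertices opposite to it have the same height. -/
theorem salient_iff {T : Set Calisson} (hT : IsTiling T) {g : Point → ℤ}
    (hg : ∀ p i, g (p + unit i) = g p + overlap T p i) {i j k : Fin 3} (hij : i ≠ j)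
    (hjk : j ≠ k) (hki : k ≠ i) (p : Point) (h0 : overlap T p i = 0) :
    (∀ c ∈ T, ∀ c' ∈ T, c ≠ c' → s(proj p, proj p + dir i) ∈ c.sides →
      s(proj p, proj p + dir i) ∈ c'.sides → c.color ≠ c'.color) ↔
      g (p - unit j) = g (p - unit k) := by
  have hpj : proj (p - unit j) + dir j = proj p := by rw [proj_add_dir, sub_add_cancel]
  have hpk : proj (p - unit k) + dir k = proj p := by rw [proj_add_dir, sub_add_cancel]
  -- the four calissons around the edge, expressed by their diagonals
  have a1 := @overlap_eq_one_iff T (p - unit j) j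
  have a2 := @overlap_eq_one_iff T (p + unit i) j
  have a3 := @overlap_eq_one_iff T (p - unit k) k
  have a4 := @overlap_eq_one_iff T (p + unit i) k
  rw [hpj] at a1
  rw [← proj_add_dir] at a2 a4
  rw [hpk] at a3
  -- the two triangles adjacent to the edge
  have t1 := (isTiling_iff T).1 hT p i j k hij hjk hki
  have t2 := (isTiling_iff T).1 hT p i k j hki.symm hjk.symm hij.symm
  have e1 : proj (p + unit i + unit j) = proj (p - unit k) := by
    rw [← proj_add_one (p - unit k), ← add_units (p - unit k) hij hjk hki]
    congr 1; abel
  have e2 : proj (p + unit i + unit k) = proj (p - unit j) := by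
    rw [← proj_add_one (p - unit j), ← add_units (p - unit j) hij hjk hki]
    congr 1; abel
  rw [overlap_congr T e1] at t1
  rw [overlap_congr T e2] at t2
  have g1 := hg (p - unit j) j
  have g2 := hg (p - unit k) k
  rw [sub_add_cancel] at g1 g2
  have b1 := overlap_eq_zero_or_one T (p - unit j) j
  have b2 := overlap_eq_zero_or_one T (p + unit i) j
  have n1 : (⟨proj p, j⟩ : Calisson) ≠ ⟨proj p + dir i + dir j, j⟩ := by
    intro h
    have h := congrArg Calisson.base h
    change proj p = proj (p + unit i + unit j) at h
    rw [proj_eq_proj_of_distinct hij hjk hki] at h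
    simp [hij, hij.symm, hjk.symm, hki] at h
  have n2 : (⟨proj p, k⟩ : Calisson) ≠ ⟨proj p + dir i + dir k, k⟩ := by
    intro h
    have h := congrArg Calisson.base h
    change proj p = proj (p + unit i + unit k) at h
    rw [proj_eq_proj_of_distinct hij hjk hki] at h
    simp [hij.symm, hjk, hki.symm] at h
  have key : (∀ c ∈ T, ∀ c' ∈ T, c ≠ c' → s(proj p, proj p + dir i) ∈ c.sides →
      s(proj p, proj p + dir i) ∈ c'.sides → c.color ≠ c'.color) ↔
      ¬ ((⟨proj p, j⟩ : Calisson) ∈ T ∧ (⟨proj p + dir i + dir j, j⟩ : Calisson) ∈ T) ∧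
      ¬ ((⟨proj p, k⟩ : Calisson) ∈ T ∧ (⟨proj p + dir i + dir k, k⟩ : Calisson) ∈ T) := by
    simp only [edge_mem_sides_iff (proj p) hij hjk hki]
    constructor
    · intro h
      exact ⟨fun ⟨m1, m2⟩ => h _ m1 _ m2 n1 (by simp) (by simp) rfl,
        fun ⟨m1, m2⟩ => h _ m1 _ m2 n2 (by simp) (by simp) rfl⟩
    · rintro ⟨h1, h2⟩ c hc c' hc' hne ((rfl | rfl) | (rfl | rfl)) ((rfl | rfl) | (rfl | rfl)) <;>
        first
        | exact absurd rfl hne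
        | exact (h1 ⟨hc, hc'⟩).elim
        | exact (h1 ⟨hc', hc⟩).elim
        | exact (h2 ⟨hc, hc'⟩).elim
        | exact (h2 ⟨hc', hc⟩).elim
        | exact hjk
        | exact hjk.symm
  rw [key, ← a1, ← a2, ← a3, ← a4]
  omega

/-- The puzzle in terms of heights. -/
theorem hasSolution_iff {l : List EdgeCode} {X : Finset (Sym2 Vertex)} (h : Enumerates l X) :
    HasSolution X ↔ ∃ g : Point → ℤ, IsHeight g ∧ ∀ w ∈ l,
      g (w.origin + unit w.direction) = g w.origin ∧
      g (w.origin - unit (w.direction + 1)) = g (w.origin - unit (w.direction + 2)) := by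
  have hd : ∀ i : Fin 3, i ≠ i + 1 ∧ i + 1 ≠ i + 2 ∧ i + 2 ≠ i := by decide
  have key : ∀ (T : Set Calisson) (g : Point → ℤ), IsTiling T →
      (∀ p i, g (p + unit i) = g p + overlap T p i) → ((NonOverlap X T ∧ Salient X T) ↔ ∀ w ∈ l,
        g (w.origin + unit w.direction) = g w.origin ∧
        g (w.origin - unit (w.direction + 1)) = g (w.origin - unit (w.direction + 2))) := by
    intro T g hT hg
    have hz : ∀ p i, g (p + unit i) = g p ↔ overlap T p i = 0 := by
      intro p i; have := hg p i; omega
    have hX : ∀ Q : Sym2 Vertex → Prop, (∀ e ∈ (X : Set (Sym2 Vertex)), Q e) ↔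
        ∀ w ∈ l, Q s(proj w.origin, proj w.origin + dir w.direction) := by
      intro Q
      simp only [Finset.mem_coe, h.2, List.forall_mem_map]
      rfl
    unfold NonOverlap Salient
    rw [hX, hX]
    constructor
    · rintro ⟨h1, h2⟩ w hw
      obtain ⟨d1, d2, d3⟩ := hd w.direction
      have h0 := (diagonal_ne_iff T _ _).1 (h1 w hw)
      exact ⟨(hz _ _).2 h0, (salient_iff hT hg d1 d2 d3 _ h0).1 (h2 w hw)⟩
    · intro h
      refine ⟨fun w hw => (diagonal_ne_iff T _ _).2 ((hz _ _).1 (h w hw).1), fun w hw => ?_⟩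
      obtain ⟨d1, d2, d3⟩ := hd w.direction
      exact (salient_iff hT hg d1 d2 d3 _ ((hz _ _).1 (h w hw).1)).2 (h w hw).2
  constructor
  · rintro ⟨T, hT, hX⟩
    obtain ⟨g, hg, hgT⟩ := exists_height_of_isTiling hT
    exact ⟨g, hg, (key T g hT hgT).1 hX⟩
  · rintro ⟨g, hg, hl⟩
    obtain ⟨T, hT, hgT⟩ := exists_isTiling_of_height hg
    exact ⟨T, hT, (key T g hT hgT).2 hl⟩

/-! ### Heights and difference constraints -/

/-- A point whose height is a variable of the system of constraints. The variable is named by the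
memory cell that holds its value. -/
structure Site where
  pos : Point
  addr : ℤ

/-- The smallest coordinate of a point. -/
def minCoord (p : Point) : ℤ := min (min (p 0) (p 1)) (p 2)

/-- The constraint that monotonicity imposes on the heights of two points. -/
def siteArc (a b : Site) : Arc ℤ := ⟨a.addr, b.addr, minCoord (b.pos - a.pos)⟩

/-- All constraints between the sites of a list. -/
def siteArcs (L : List Site) : List (Arc ℤ) := L.flatMap fun a => L.map (siteArc a)

/-- The four points around the edge number `m`. An edge of the puzzle forces the heights of its two
ends to agree, and likewise the heights of the two points opposite to it, so that two variables
suffice. -/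
def edgeSites (m : ℕ) (w : EdgeCode) : List Site :=
  [⟨w.origin - unit (w.direction + 2), 4 * m + 1⟩, ⟨w.origin - unit (w.direction + 1), 4 * m + 1⟩,
    ⟨w.origin + unit w.direction, 4 * m⟩, ⟨w.origin, 4 * m⟩]

/-- The sites of a list of edges numbered from `m` on, in front of those found before. -/
def sites : ℕ → List EdgeCode → List Site → List Site
  | _, [], L => L
  | m, w :: l, L => sites (m + 1) l (edgeSites m w ++ L)

theorem mem_sites {a : Site} (m : ℕ) (l : List EdgeCode) (L : List Site) :
    a ∈ sites m l L ↔ a ∈ L ∨ ∃ k w, l[k]? = some w ∧ a ∈ edgeSites (m + k) w := by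
  induction l generalizing m L with
  | nil => simp [sites]
  | cons w l ih =>
    rw [sites, ih, List.mem_append]
    constructor
    · rintro ((h | h) | ⟨k, v, hk, h⟩)
      · exact Or.inr ⟨0, w, rfl, h⟩
      · exact Or.inl h
      · exact Or.inr ⟨k + 1, v, hk, by rwa [Nat.add_right_comm, Nat.add_assoc] at h⟩
    · rintro (h | ⟨k, v, hk, h⟩)
      · exact Or.inl (Or.inr h)
      · cases k with
        | zero =>
          obtain rfl : w = v := by simpa using hk
          exact Or.inl (Or.inl h)
        | succ k =>
          exact Or.inr ⟨k, v, by simpa using hk, by rwa [Nat.add_right_comm, Nat.add_assoc]⟩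

theorem length_sites (m : ℕ) (l : List EdgeCode) (L : List Site) :
    (sites m l L).length = 4 * l.length + L.length := by
  induction l generalizing m L with
  | nil => simp [sites]
  | cons w l ih => rw [sites, ih]; simp [edgeSites]; omega

theorem addr_nonneg_of_mem_sites {a : Site} {l : List EdgeCode} (h : a ∈ sites 0 l []) :
    0 ≤ a.addr := by
  rw [mem_sites] at h
  obtain h | ⟨k, w, -, h⟩ := h
  · simp at h
  · simp only [edgeSites, List.mem_cons, List.not_mem_nil, or_false] at h
    rcases h with rfl | rfl | rfl | rfl <;> simp only <;> omega

theorem mem_siteArcs {L : List Site} {c : Arc ℤ} :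
    c ∈ siteArcs L ↔ ∃ a ∈ L, ∃ b ∈ L, siteArc a b = c := by
  simp [siteArcs]

theorem minCoord_zero : minCoord 0 = 0 := rfl

theorem minCoord_add_one (p : Point) : minCoord (p + 1) = minCoord p + 1 := by
  simp only [minCoord, Pi.add_apply, Pi.one_apply]; omega

theorem minCoord_mono {p q : Point} (h : p ≤ q) : minCoord p ≤ minCoord q := by
  have h0 : p 0 ≤ q 0 := h 0
  have h1 : p 1 ≤ q 1 := h 1
  have h2 : p 2 ≤ q 2 := h 2
  simp only [minCoord]; omega

theorem minCoord_smul_le (p : Point) : minCoord p • 1 ≤ p := by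
  intro i
  fin_cases i <;> simp [minCoord]

/-- A height on finitely many points extends to the whole grid. -/
theorem exists_height_of_siteArcs {L : List Site} {u : ℤ → ℤ}
    (hu : ∀ c ∈ siteArcs L, c.Holds u) :
    ∃ g : Point → ℤ, IsHeight g ∧ ∀ a ∈ L, g a.pos = u a.addr := by
  classical
  by_cases hL : L = []
  · subst hL
    exact ⟨fun p => p 0, ⟨fun p => rfl, fun p q h => h 0⟩, by simp⟩
  have hne : L.toFinset.Nonempty := (List.toFinset_nonempty_iff L).2 hL
  refine ⟨fun q => L.toFinset.sup' hne fun a => u a.addr + minCoord (q - a.pos), ⟨?_, ?_⟩, ?_⟩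
  · intro p
    have h : ∀ a : Site, u a.addr + minCoord (p + 1 - a.pos) =
        u a.addr + minCoord (p - a.pos) + 1 := by
      intro a
      rw [add_sub_right_comm, minCoord_add_one]; ring
    simp only [h]
    refine le_antisymm (Finset.sup'_le _ _ fun a ha => ?_) ?_
    · have := Finset.le_sup' (fun a : Site => u a.addr + minCoord (p - a.pos)) ha
      omega
    · rw [← le_sub_iff_add_le]
      refine Finset.sup'_le _ _ fun a ha => ?_
      have := Finset.le_sup' (fun a : Site => u a.addr + minCoord (p - a.pos) + 1) ha
      omega
  · intro p q hpq
    refine Finset.sup'_le _ _ fun a ha => ?_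
    refine le_trans ?_ (Finset.le_sup' (fun a : Site => u a.addr + minCoord (q - a.pos)) ha)
    have := minCoord_mono (sub_le_sub_right hpq a.pos)
    omega
  · intro b hb
    refine le_antisymm (Finset.sup'_le _ _ fun a ha => ?_) ?_
    · exact hu (siteArc a b) (mem_siteArcs.2 ⟨a, List.mem_toFinset.1 ha, b, hb, rfl⟩)
    · refine le_trans ?_ (Finset.le_sup' (fun a : Site => u a.addr + minCoord (b.pos - a.pos))
        (List.mem_toFinset.2 hb))
      simp [minCoord_zero]

/-- The heights that respect the edges of the puzzle correspond to the solutions of the system of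
constraints between the sites. -/
theorem exists_height_iff (l : List EdgeCode) :
    (∃ g : Point → ℤ, IsHeight g ∧ ∀ w ∈ l,
      g (w.origin + unit w.direction) = g w.origin ∧
      g (w.origin - unit (w.direction + 1)) = g (w.origin - unit (w.direction + 2))) ↔
    ∃ u : ℤ → ℤ, ∀ c ∈ siteArcs (sites 0 l []), c.Holds u := by
  constructor
  · rintro ⟨g, hg, hl⟩
    -- the variable `4 * k` is the height of the ends of the edge number `k`, the variable `4 * k + 1`
    -- that of the opposite points
    set u : ℤ → ℤ := fun a => match l[(a / 4).toNat]? with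
      | some w => if a % 4 = 0 then g w.origin else g (w.origin - unit (w.direction + 1))
      | none => 0 with hu
    have hus : ∀ a ∈ sites 0 l [], u a.addr = g a.pos := by
      intro a ha
      rw [mem_sites] at ha
      obtain h | ⟨k, w, hk, h⟩ := ha
      · simp at h
      · have hw := hl w (List.mem_of_getElem? hk)
        have u0 : u (4 * k) = g w.origin := by
          have h1 : ((4 * (k : ℤ)) / 4).toNat = k := by omega
          simp only [hu, h1, hk]
          exact if_pos (by omega)
        have u1 : u (4 * k + 1) = g (w.origin - unit (w.direction + 1)) := by
          have h1 : ((4 * (k : ℤ) + 1) / 4).toNat = k := by omega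
          simp only [hu, h1, hk]
          exact if_neg (by omega)
        simp only [edgeSites, List.mem_cons, List.not_mem_nil, or_false, Nat.zero_add] at h
        rcases h with rfl | rfl | rfl | rfl
        · exact u1.trans hw.2
        · exact u1
        · exact u0.trans hw.1.symm
        · exact u0
    refine ⟨u, fun c hc => ?_⟩
    obtain ⟨a, ha, b, hb, rfl⟩ := mem_siteArcs.1 hc
    change u a.addr + minCoord (b.pos - a.pos) ≤ u b.addr
    rw [hus a ha, hus b hb, ← hg.add_zsmul_one]
    refine hg.mono ?_
    rw [← le_sub_iff_add_le']
    exact minCoord_smul_le _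
  · rintro ⟨u, hu⟩
    obtain ⟨g, hg, hgu⟩ := exists_height_of_siteArcs hu
    refine ⟨g, hg, fun w hw => ?_⟩
    obtain ⟨k, hk⟩ := List.mem_iff_getElem?.1 hw
    have h : ∀ a ∈ edgeSites k w, g a.pos = u a.addr := fun a ha =>
      hgu a ((mem_sites 0 l []).2 (Or.inr ⟨k, w, hk, by rwa [Nat.zero_add]⟩))
    simp only [edgeSites, List.forall_mem_cons, List.not_mem_nil] at h
    obtain ⟨h1, h2, h3, h4, -⟩ := h
    exact ⟨h3.trans h4.symm, h2.trans h1.symm⟩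

/-! ### Reasoning about programs -/

/-- Started in `s`, the program halts within `B` steps, in a state that satisfies `Q`. -/
def RunsIn (P : Program) (s : State) (B : ℕ) (Q : State → Prop) : Prop :=
  ∃ t s', Exec P s t s' ∧ t ≤ B ∧ Q s'

namespace Program

/-- The registers that a program may change. -/
def written : Program → List ℕ
  | skip => []
  | const r _ => [r]
  | add r _ _ => [r]
  | sub r _ _ => [r]
  | load r _ => [r]
  | store _ _ => []
  | seq P Q => P.written ++ Q.written
  | branch _ P Q => P.written ++ Q.written
  | loop _ P => P.written

/-- A program without loops. -/
def LoopFree : Program → Prop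
  | seq P Q => P.LoopFree ∧ Q.LoopFree
  | branch _ P Q => P.LoopFree ∧ Q.LoopFree
  | loop _ _ => False
  | _ => True

/-- The final state of a program without loops. The value for loops is irrelevant. -/
def eval : Program → State → State
  | skip, s => s
  | const r z, s => s.setReg r z
  | add r a b, s => s.setReg r (s.reg a + s.reg b)
  | sub r a b, s => s.setReg r (s.reg a - s.reg b)
  | load r a, s => s.setReg r (s.mem (s.reg a))
  | store a b, s => s.setMem (s.reg a) (s.reg b)
  | seq P Q, s => Q.eval (P.eval s)
  | branch r P Q, s => if 0 < s.reg r then P.eval s else Q.eval s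
  | loop _ _, s => s

/-- A bound for the number of steps of a program without loops. The value for loops is
irrelevant. -/
def cost : Program → ℕ
  | seq P Q => P.cost + Q.cost
  | branch _ P Q => P.cost + Q.cost + 1
  | _ => 1

/-- The programs of a list, one after the other. -/
def block : List Program → Program
  | [] => skip
  | P :: l => seq P (block l)

/-- `reg r := min (reg a) (reg b)`, with the auxiliary register `t`. -/
def minInto (r t a b : ℕ) : Program :=
  seq (sub t a b) (branch t (sub r a t) (add r b t))

theorem eval_minInto (r : ℕ) {t a b : ℕ} (ha : a ≠ t) (hb : b ≠ t) (s : State) :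
    (minInto r t a b).eval s =
      (s.setReg t (s.reg a - s.reg b)).setReg r (min (s.reg a) (s.reg b)) := by
  simp only [minInto, eval, State.setReg, Function.update_self, Function.update_of_ne ha,
    Function.update_of_ne hb]
  split_ifs
  · congr 2; omega
  · congr 2; omega

end Program

theorem Exec.reg_eq {P : Program} {s s' : State} {t : ℕ} (h : Exec P s t s') {r : ℕ}
    (hr : r ∉ P.written) : s'.reg r = s.reg r := by
  induction h with
  | seq _ _ ih ih' =>
    simp only [Program.written, List.mem_append, not_or] at hr
    rw [ih' hr.2, ih hr.1]
  | branch_pos _ _ ih =>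
    simp only [Program.written, List.mem_append, not_or] at hr
    exact ih hr.1
  | branch_neg _ _ ih =>
    simp only [Program.written, List.mem_append, not_or] at hr
    exact ih hr.2
  | loop_pos _ _ _ ih ih' => rw [ih' hr, ih hr]
  | loop_neg => rfl
  | skip => rfl
  | store => rfl
  | _ => exact Function.update_of_ne (by simpa [Program.written] using hr) _ _

namespace RunsIn

theorem mono {P : Program} {s : State} {B B' : ℕ} {Q Q' : State → Prop} (h : RunsIn P s B Q)
    (hB : B ≤ B') (hQ : ∀ s', Q s' → Q' s') : RunsIn P s B' Q' := by
  obtain ⟨t, s', he, ht, hs⟩ := h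
  exact ⟨t, s', he, ht.trans hB, hQ s' hs⟩

theorem frame {P : Program} {s : State} {B : ℕ} {Q : State → Prop} (h : RunsIn P s B Q) :
    RunsIn P s B fun s' => Q s' ∧ ∀ r, r ∉ P.written → s'.reg r = s.reg r := by
  obtain ⟨t, s', he, ht, hs⟩ := h
  exact ⟨t, s', he, ht, hs, fun r hr => he.reg_eq hr⟩

theorem seq {P P' : Program} {s : State} {B B' : ℕ} {Q : State → Prop}
    (h : RunsIn P s B fun s' => RunsIn P' s' B' Q) : RunsIn (.seq P P') s (B + B') Q := by
  obtain ⟨t, s', he, ht, t', s'', he', ht', hs⟩ := h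
  exact ⟨t + t', s'', he.seq he', Nat.add_le_add ht ht', hs⟩

theorem loop_step {P : Program} {s : State} {B B' r : ℕ} {Q : State → Prop} (hr : 0 < s.reg r)
    (h : RunsIn P s B fun s' => RunsIn (.loop r P) s' B' Q) :
    RunsIn (.loop r P) s (B + B' + 1) Q := by
  obtain ⟨t, s', he, ht, t', s'', he', ht', hs⟩ := h
  exact ⟨t + t' + 1, s'', .loop_pos hr he he', by omega, hs⟩

theorem loop_done {P : Program} {s : State} {r : ℕ} {Q : State → Prop} (hr : ¬ 0 < s.reg r)
    (h : Q s) : RunsIn (.loop r P) s 1 Q :=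
  ⟨1, s, .loop_neg hr, le_rfl, h⟩

theorem eval {P : Program} (hP : P.LoopFree) (s : State) {Q : State → Prop} (h : Q (P.eval s)) :
    RunsIn P s P.cost Q := by
  suffices key : RunsIn P s P.cost fun s' => s' = P.eval s from
    key.mono le_rfl (by rintro _ rfl; exact h)
  clear h
  induction P generalizing s with
  | seq P P' ih ih' =>
    refine seq ((ih hP.1 s).mono le_rfl ?_)
    rintro _ rfl
    exact ih' hP.2 _
  | branch r P P' ih ih' =>
    by_cases hr : 0 < s.reg r
    · obtain ⟨t, s', he, ht, rfl⟩ := ih hP.1 s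
      exact ⟨t + 1, _, .branch_pos hr he, by simp only [Program.cost]; omega, (if_pos hr).symm⟩
    · obtain ⟨t, s', he, ht, rfl⟩ := ih' hP.2 s
      exact ⟨t + 1, _, .branch_neg hr he, by simp only [Program.cost]; omega, (if_neg hr).symm⟩
  | loop => exact hP.elim
  | skip => exact ⟨1, _, .skip _, le_rfl, rfl⟩
  | const r z => exact ⟨1, _, .const _ _ _, le_rfl, rfl⟩
  | add r a b => exact ⟨1, _, .add _ _ _ _, le_rfl, rfl⟩
  | sub r a b => exact ⟨1, _, .sub _ _ _ _, le_rfl, rfl⟩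
  | load r a => exact ⟨1, _, .load _ _ _, le_rfl, rfl⟩
  | store a b => exact ⟨1, _, .store _ _ _, le_rfl, rfl⟩

end RunsIn

/-! ### The Bellman–Ford method on the machine -/

/-- The memory holds the sites of a list, the last one in the cells `-4, …, -1`, the one before it
in the cells `-8, …, -5`, and so on. -/
def Stored (M : ℤ → ℤ) : List Site → Prop
  | [] => True
  | a :: L => (M (-(4 * L.length + 4)) = a.pos 0 ∧ M (-(4 * L.length + 4) + 1) = a.pos 1 ∧
      M (-(4 * L.length + 4) + 1 + 1) = a.pos 2 ∧ M (-(4 * L.length + 4) + 1 + 1 + 1) = a.addr) ∧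
      Stored M L

theorem Stored.congr {M M' : ℤ → ℤ} {L : List Site} (h : Stored M L) {k : ℤ}
    (hk : -(4 * L.length) = k) (hM : ∀ a, k ≤ a → a < 0 → M' a = M a) : Stored M' L := by
  subst hk
  induction L with
  | nil => trivial
  | cons a L ih =>
    obtain ⟨⟨h0, h1, h2, h3⟩, h4⟩ := h
    simp only [List.length_cons] at hM
    push_cast at hM
    refine ⟨⟨?_, ?_, ?_, ?_⟩, ih h4 fun b hb hb' => hM b (by omega) hb'⟩
    · rw [hM _ (by omega) (by omega), h0]
    · rw [hM _ (by omega) (by omega), h1]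
    · rw [hM _ (by omega) (by omega), h2]
    · rw [hM _ (by omega) (by omega), h3]

/-- The contents of the registers that hold constants. In the whole program, register `4` holds the
number of cells that the sites occupy, register `5` counts the rounds, registers `10` and `20` run
through the sources and targets of the constraints, and register `30` is the flag. -/
structure Constants (s : State) : Prop where
  one : s.reg 1 = 1
  four : s.reg 2 = 4
  zero : s.reg 3 = 0

theorem Constants.congr {s s' : State} (h : Constants s) {P : Program}
    (hs : ∀ r, r ∉ P.written → s'.reg r = s.reg r)
    (hP : 1 ∉ P.written ∧ 2 ∉ P.written ∧ 3 ∉ P.written) : Constants s' :=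
  ⟨(hs 1 hP.1).trans h.one, (hs 2 hP.2.1).trans h.four, (hs 3 hP.2.2).trans h.zero⟩

namespace Program

/-- Computes the value that the constraint from the site in the registers `11, …, 14` requires at the
site that is stored at the address `- reg 20`, and moves on to the next site. -/
def loadTarget : Program :=
  block [sub 25 3 20, load 21 25, add 25 25 1, load 22 25, add 25 25 1, load 23 25, add 25 25 1,
    load 24 25, sub 21 21 11, sub 22 22 12, sub 23 23 13, minInto 26 27 21 22, minInto 26 27 26 23,
    load 27 14, add 26 27 26, load 28 24, sub 29 26 28, sub 20 20 2]

/-- Relaxes the constraint from the site in the registers `11, …, 14` to the site that is stored at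
the address `- reg 20`, and moves on to the next site. -/
def relaxBody : Program :=
  seq loadTarget (branch 29 (seq (store 24 26) (const 30 1)) skip)

/-- Loads the site at the address `- reg 10` into the registers `11, …, 14`, and starts the
enumeration of all targets in register `20`. -/
def loadSource : Program :=
  block [sub 15 3 10, load 11 15, add 15 15 1, load 12 15, add 15 15 1, load 13 15, add 15 15 1,
    load 14 15, add 20 4 3, sub 10 10 2]

/-- Relaxes all constraints from one site. -/
def sourceBody : Program := seq loadSource (loop 20 relaxBody)

/-- One round of the Bellman–Ford method. -/
def roundBody : Program :=
  seq (block [const 30 0, add 10 4 3, sub 5 5 1]) (loop 10 sourceBody)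

end Program

open Program

theorem runsIn_relaxBody {a b : Site} {L : List Site} {s : State} (hc : Constants s)
    (h0 : s.reg 11 = a.pos 0) (h1 : s.reg 12 = a.pos 1) (h2 : s.reg 13 = a.pos 2)
    (h3 : s.reg 14 = a.addr) (hq : s.reg 20 = 4 * L.length + 4) (hL : Stored s.mem (b :: L)) :
    RunsIn relaxBody s relaxBody.cost fun s' => s'.reg 20 = 4 * L.length ∧
      (s'.mem, s'.reg 30) = relax (s.mem, s.reg 30) (siteArc a b) := by
  obtain ⟨⟨b0, b1, b2, b3⟩, -⟩ := hL
  generalize hq' : 4 * (L.length : ℤ) + 4 = q at *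
  set s₁ := loadTarget.eval s with hs₁
  have load : s₁.reg 24 = b.addr ∧ s₁.reg 26 = s.mem a.addr + minCoord (b.pos - a.pos) ∧
      s₁.reg 29 = s.mem a.addr + minCoord (b.pos - a.pos) - s.mem b.addr ∧
      s₁.reg 20 = q - 4 ∧ s₁.reg 30 = s.reg 30 ∧ s₁.mem = s.mem := by
    simp [hs₁, loadTarget, block, Program.eval, eval_minInto, State.setReg, minCoord,
      hc.one, hc.four, hc.zero, h0, h1, h2, h3, hq, b0, b1, b2, b3]
  obtain ⟨e24, e26, e29, e20, e30, eM⟩ := load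
  refine RunsIn.eval (by simp [relaxBody, loadTarget, block, minInto, LoopFree]) s ?_
  simp only [relaxBody, Program.eval, ← hs₁, State.setReg, State.setMem, relax, siteArc, e24, e26,
    e29, sub_pos, eM]
  split_ifs with h
  · simp [e20, ← hq', h]
  · simp [e20, e30, eM, ← hq', h]

theorem runsIn_loop_relaxBody {a : Site} {L : List Site} (hL : ∀ b ∈ L, 0 ≤ b.addr) {s : State}
    (hc : Constants s) (h0 : s.reg 11 = a.pos 0) (h1 : s.reg 12 = a.pos 1)
    (h2 : s.reg 13 = a.pos 2) (h3 : s.reg 14 = a.addr) (hq : s.reg 20 = 4 * L.length)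
    (hS : Stored s.mem L) :
    RunsIn (.loop 20 relaxBody) s ((relaxBody.cost + 1) * L.length + 1) fun s' =>
      (s'.mem, s'.reg 30) = (L.map (siteArc a)).foldl relax (s.mem, s.reg 30) := by
  induction L generalizing s with
  | nil => exact RunsIn.loop_done (by simp [hq]) rfl
  | cons b L ih =>
    simp only [List.length_cons] at hq ⊢
    push_cast at hq
    refine (RunsIn.loop_step (by omega)
      ((runsIn_relaxBody hc h0 h1 h2 h3 (by omega) hS).frame.mono le_rfl ?_)).mono
        (B := relaxBody.cost + ((relaxBody.cost + 1) * L.length + 1) + 1)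
        (by rw [Nat.mul_succ]; omega) fun _ h => h
    rintro s' ⟨⟨h20, hst⟩, hf⟩
    have hmem : s'.mem = (relax (s.mem, s.reg 30) (siteArc a b)).1 := congrArg Prod.fst hst
    refine (ih (fun c hc => hL c (List.mem_cons_of_mem _ hc)) (hc.congr hf (by decide))
      ((hf 11 (by decide)).trans h0) ((hf 12 (by decide)).trans h1) ((hf 13 (by decide)).trans h2)
      ((hf 14 (by decide)).trans h3) h20 ?_).mono le_rfl fun s'' hs'' => ?_
    · refine hS.2.congr rfl fun c _ hc => ?_
      rw [hmem, relax_fst_of_ne]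
      have := hL b List.mem_cons_self
      simp only [siteArc]
      omega
    · rw [hs'', hst, List.map_cons, List.foldl_cons]

theorem runsIn_sourceBody {a : Site} {L L' : List Site} (hL : ∀ b ∈ L, 0 ≤ b.addr) {s : State}
    (hc : Constants s) (h4 : s.reg 4 = 4 * L.length) (hp : s.reg 10 = 4 * L'.length + 4)
    (hS : Stored s.mem L) (hS' : Stored s.mem (a :: L')) :
    RunsIn sourceBody s (loadSource.cost + ((relaxBody.cost + 1) * L.length + 1)) fun s' =>
      s'.reg 10 = 4 * L'.length ∧
        (s'.mem, s'.reg 30) = (L.map (siteArc a)).foldl relax (s.mem, s.reg 30) := by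
  obtain ⟨⟨a0, a1, a2, a3⟩, -⟩ := hS'
  generalize hq' : 4 * (L'.length : ℤ) + 4 = q at *
  set s₁ := loadSource.eval s with hs₁
  have load : s₁.reg 11 = a.pos 0 ∧ s₁.reg 12 = a.pos 1 ∧ s₁.reg 13 = a.pos 2 ∧
      s₁.reg 14 = a.addr ∧ s₁.reg 20 = 4 * L.length ∧ s₁.reg 10 = q - 4 ∧
      s₁.reg 30 = s.reg 30 ∧ s₁.mem = s.mem ∧ Constants s₁ := by
    refine ⟨?_, ?_, ?_, ?_, ?_, ?_, ?_, ?_, ?_, ?_, ?_⟩ <;>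
    simp [hs₁, loadSource, block, Program.eval, State.setReg,
      hc.one, hc.four, hc.zero, hp, a0, a1, a2, a3, h4]
  obtain ⟨e11, e12, e13, e14, e20, e10, e30, eM, hc₁⟩ := load
  refine RunsIn.seq (RunsIn.eval (by simp [loadSource, block, LoopFree]) s ?_)
  refine (runsIn_loop_relaxBody hL hc₁ e11 e12 e13 e14 e20 (eM ▸ hS)).frame.mono le_rfl ?_
  rintro s' ⟨hst, hf⟩
  rw [hst, hf 10 (by decide), e10, eM, e30]
  exact ⟨by omega, rfl⟩

theorem runsIn_loop_sourceBody {L : List Site} (hL : ∀ b ∈ L, 0 ≤ b.addr) {L' : List Site}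
    {s : State} (hc : Constants s) (h4 : s.reg 4 = 4 * L.length) (hp : s.reg 10 = 4 * L'.length)
    (hS : Stored s.mem L) (hS' : Stored s.mem L') :
    RunsIn (.loop 10 sourceBody) s
      ((loadSource.cost + ((relaxBody.cost + 1) * L.length + 1) + 1) * L'.length + 1) fun s' =>
        (s'.mem, s'.reg 30) =
          (L'.flatMap fun a => L.map (siteArc a)).foldl relax (s.mem, s.reg 30) := by
  induction L' generalizing s with
  | nil => exact RunsIn.loop_done (by simp [hp]) rfl
  | cons a L' ih =>
    simp only [List.length_cons] at hp ⊢
    push_cast at hp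
    set B := loadSource.cost + ((relaxBody.cost + 1) * L.length + 1) with hB
    refine (RunsIn.loop_step (by omega)
      ((runsIn_sourceBody hL hc h4 (by omega) hS hS').frame.mono le_rfl ?_)).mono
        (B := B + ((B + 1) * L'.length + 1) + 1) (by rw [Nat.mul_succ]; omega) fun _ h => h
    rintro s' ⟨⟨h10, hst⟩, hf⟩
    have hmem : ∀ c < 0, s'.mem c = s.mem c := by
      intro c hc
      rw [show s'.mem = _ from congrArg Prod.fst hst]
      refine foldl_relax_fst_of_ne fun d hd => ?_
      obtain ⟨b, hb, rfl⟩ := List.mem_map.1 hd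
      have := hL b hb
      simp only [siteArc]
      omega
    refine (ih (hc.congr hf (by decide)) ((hf 4 (by decide)).trans h4) h10
      (hS.congr rfl fun c _ => hmem c) (hS'.2.congr rfl fun c _ => hmem c)).mono le_rfl
      fun s'' hs'' => ?_
    rw [hs'', hst, List.flatMap_cons, List.foldl_append]

theorem runsIn_loop_roundBody {L : List Site} (hL : ∀ b ∈ L, 0 ≤ b.addr) (k : ℕ)
    {s : State} (hc : Constants s) (h4 : s.reg 4 = 4 * L.length) (h5 : s.reg 5 = k)
    (hS : Stored s.mem L) :
    RunsIn (.loop 5 roundBody) s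
      ((5 + ((loadSource.cost + ((relaxBody.cost + 1) * L.length + 1) + 1) * L.length + 1)) * k + 1)
      fun s' => (s'.mem, s'.reg 30) =
        (bellmanFordRound (siteArcs L))^[k] (s.mem, s.reg 30) := by
  induction k generalizing s with
  | zero => exact RunsIn.loop_done (by simp [h5]) rfl
  | succ k ih =>
    push_cast at h5
    set B := (loadSource.cost + ((relaxBody.cost + 1) * L.length + 1) + 1) * L.length + 1 with hB
    set init : Program := block [const 30 0, add 10 4 3, sub 5 5 1] with hinit
    set s₁ := init.eval s with hs₁
    have load : s₁.reg 10 = 4 * L.length ∧ s₁.reg 5 = k ∧ s₁.reg 4 = 4 * L.length ∧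
        s₁.reg 30 = 0 ∧ s₁.mem = s.mem ∧ Constants s₁ := by
      refine ⟨?_, ?_, ?_, ?_, ?_, ?_, ?_, ?_⟩ <;>
      simp [hs₁, hinit, block, Program.eval, State.setReg, hc.one, hc.four, hc.zero, h4, h5]
    obtain ⟨e10, e5, e4, e30, eM, hc₁⟩ := load
    have body : RunsIn roundBody s (4 + B) fun s' => s'.reg 5 = k ∧ s'.reg 4 = 4 * L.length ∧
        (s'.mem, s'.reg 30) = bellmanFordRound (siteArcs L) (s.mem, s.reg 30) := by
      refine RunsIn.seq ((RunsIn.eval (P := init) (by simp [hinit, block, LoopFree]) s ?_))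
      refine (runsIn_loop_sourceBody hL hc₁ e4 e10 (eM ▸ hS) (eM ▸ hS)).frame.mono le_rfl ?_
      rintro s' ⟨hst, hf⟩
      rw [hst, hf 5 (by decide), hf 4 (by decide), eM, e30]
      exact ⟨e5, e4, rfl⟩
    refine (RunsIn.loop_step (by omega) (body.frame.mono le_rfl ?_)).mono
      (B := 4 + B + ((5 + B) * k + 1) + 1) (by rw [Nat.mul_succ]; omega) fun _ h => h
    rintro s' ⟨⟨e5', e4', hst⟩, hf⟩
    have hmem : ∀ c < 0, s'.mem c = s.mem c := by
      intro c hc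
      rw [show s'.mem = _ from congrArg Prod.fst hst]
      refine foldl_relax_fst_of_ne (st := (s.mem, 0)) fun d hd => ?_
      obtain ⟨a, -, b, hb, rfl⟩ := mem_siteArcs.1 hd
      have := hL b hb
      simp only [siteArc]
      omega
    refine (ih (hc.congr hf (by decide)) e4' e5' (hS.congr rfl fun c _ => hmem c)).mono le_rfl
      fun s'' hs'' => ?_
    rw [hs'', hst, Function.iterate_succ_apply]

/-! ### Reading the input -/

/-- The memory holds the codes of a list, from the cell `4 * m` on. -/
def InputAt (M : ℤ → ℤ) : ℕ → List EdgeCode → Prop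
  | _, [] => True
  | m, w :: l => (M (4 * m) = w.origin 0 ∧ M (4 * m + 1) = w.origin 1 ∧
      M (4 * m + 1 + 1) = w.origin 2 ∧ M (4 * m + 1 + 1 + 1) = ((w.direction : ℕ) : ℤ)) ∧
      InputAt M (m + 1) l

theorem InputAt.congr {M M' : ℤ → ℤ} {m : ℕ} {l : List EdgeCode} (h : InputAt M m l)
    (hM : ∀ a, 0 ≤ a → M' a = M a) : InputAt M' m l := by
  induction l generalizing m with
  | nil => trivial
  | cons w l ih =>
    obtain ⟨⟨h0, h1, h2, h3⟩, h4⟩ := h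
    refine ⟨⟨?_, ?_, ?_, ?_⟩, ih h4⟩ <;> rw [hM _ (by omega)] <;> assumption

theorem inputAt_inputState (l : List EdgeCode) : InputAt (inputState l).mem 0 l := by
  suffices key : ∀ (l : List EdgeCode) (pre : List ℤ) (m : ℕ), pre.length = 4 * m →
      InputAt (fun a => if 0 ≤ a then (pre ++ l.flatMap EdgeCode.toInts).getD a.toNat 0 else 0) m l
    from key l [] 0 rfl
  intro l
  induction l with
  | nil => exact fun _ _ _ => trivial
  | cons w l ih =>
    intro pre m hm
    have h := ih (pre ++ w.toInts) (m + 1) (by simp [hm, EdgeCode.toInts]; omega)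
    rw [List.append_assoc] at h
    refine ⟨?_, h⟩
    have key : ∀ (j : ℕ) (a : ℤ), a = 4 * m + j → (hj : j < 4) →
        (if 0 ≤ a then (pre ++ (w :: l).flatMap EdgeCode.toInts).getD a.toNat 0 else 0) =
          w.toInts.getD j 0 := by
      rintro j _ rfl hj
      rw [if_pos (by omega), show (4 * (m : ℤ) + j).toNat = 4 * m + j by omega,
        List.getD_append_right _ _ _ _ (by omega), List.flatMap_cons,
        List.getD_append _ _ _ _ (by simp [EdgeCode.toInts]; omega)]
      congr 1
      omega
    exact ⟨key 0 _ (by simp) (by omega), key 1 _ (by simp) (by omega),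
      key 2 _ (by push_cast; ring) (by omega), key 3 _ (by push_cast; ring) (by omega)⟩

namespace Program

/-- Stores a site with the coordinates in the registers `x`, `y`, `z` and the variable in the
register `a`. Register `4` holds the number of cells that sites occupy. -/
def emit (x y z a : ℕ) : Program :=
  block [add 4 4 2, sub 20 3 4, store 20 x, add 20 20 1, store 20 y, add 20 20 1, store 20 z,
    add 20 20 1, store 20 a]

/-- Reads the code of an edge. The indicators of its direction in the registers `16`, `17`, `18`
also serve, rotated, as the unit vectors of the two other directions. -/
def readCode : Program :=
  block [load 10 6, add 6 6 1, load 11 6, add 6 6 1, load 12 6, add 6 6 1, load 13 6, add 6 6 1,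
    sub 14 6 2, add 15 14 1, const 16 0, const 17 0, const 18 0,
    branch 13 (seq (sub 19 13 1) (branch 19 (const 18 1) (const 17 1))) (const 16 1)]

/-- Computes the points around an edge. -/
def computePoints : Program :=
  block [add 21 10 16, add 22 11 17, add 23 12 18, sub 24 10 18, sub 25 11 16, sub 26 12 17,
    sub 27 10 17, sub 28 11 18, sub 29 12 16, sub 0 0 1]

/-- Reads the code of an edge and stores the sites around it. -/
def edgeBody : Program :=
  seq readCode (seq computePoints (seq (emit 10 11 12 14) (seq (emit 21 22 23 14)
    (seq (emit 24 25 26 15) (emit 27 28 29 15)))))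

/-- The program that decides the puzzle. Register `4` also serves as the number of rounds, which thus
exceeds the number of variables. -/
def solver : Program :=
  seq (block [const 1 1, const 2 4]) (seq (loop 0 edgeBody) (seq (add 5 4 3)
    (seq (loop 5 roundBody) (branch 30 (const 0 0) (const 0 1)))))

end Program

theorem runsIn_emit {x y z a : ℕ} (hne : ∀ r ∈ [x, y, z, a], r ≠ 4 ∧ r ≠ 20) {b : Site}
    {L : List Site} {s : State} (hc : Constants s) (hx : s.reg x = b.pos 0)
    (hy : s.reg y = b.pos 1) (hz : s.reg z = b.pos 2) (ha : s.reg a = b.addr)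
    (h4 : s.reg 4 = 4 * L.length) (hS : Stored s.mem L) :
    RunsIn (emit x y z a) s 10 fun s' => (s'.reg 4 = 4 * (b :: L).length ∧
      Stored s'.mem (b :: L) ∧ ∀ c, 0 ≤ c → s'.mem c = s.mem c) ∧
      ∀ r, r ∉ [4, 20] → s'.reg r = s.reg r := by
  simp only [List.forall_mem_cons, List.not_mem_nil] at hne
  obtain ⟨⟨x4, x20⟩, ⟨y4, y20⟩, ⟨z4, z20⟩, ⟨a4, a20⟩, -⟩ := hne
  have hw : (emit x y z a).written = [4, 20, 20, 20, 20] := rfl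
  refine (RunsIn.eval (P := emit x y z a) (by simp [emit, block, LoopFree]) s ?_).frame.mono
    (Q := fun s' => (s'.reg 4 = 4 * (b :: L).length ∧
      Stored s'.mem (b :: L) ∧ ∀ c, 0 ≤ c → s'.mem c = s.mem c) ∧
      ∀ r, r ∉ (emit x y z a).written → s'.reg r = s.reg r)
    le_rfl fun s' h => ⟨h.1, fun r hr => h.2 r (by simpa [hw] using hr)⟩
  generalize hq : 4 * (L.length : ℤ) + 4 = q
  have e4 : ((emit x y z a).eval s).reg 4 = q := by
    simp [emit, block, Program.eval, State.setReg, State.setMem, hc.four, h4, hq]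
  have eM : ((emit x y z a).eval s).mem = Function.update (Function.update (Function.update
      (Function.update s.mem (-q) (b.pos 0)) (-q + 1) (b.pos 1)) (-q + 1 + 1) (b.pos 2))
      (-q + 1 + 1 + 1) b.addr := by
    simp [emit, block, Program.eval, State.setReg, State.setMem, hc.one, hc.four, hc.zero, *]
  have key : ∀ c, c ≠ -q → c ≠ -q + 1 → c ≠ -q + 1 + 1 → c ≠ -q + 1 + 1 + 1 →
      ((emit x y z a).eval s).mem c = s.mem c := by
    intro c h1 h2 h3 h4
    rw [eM, Function.update_of_ne h4, Function.update_of_ne h3, Function.update_of_ne h2,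
      Function.update_of_ne h1]
  refine ⟨by rw [e4, ← hq]; simp; ring, ⟨⟨?_, ?_, ?_, ?_⟩, hS.congr rfl fun c hc hc' => ?_⟩,
    fun c hc => ?_⟩
  · rw [hq, eM, Function.update_of_ne (by omega), Function.update_of_ne (by omega),
      Function.update_of_ne (by omega), Function.update_self]
  · rw [hq, eM, Function.update_of_ne (by omega), Function.update_of_ne (by omega),
      Function.update_self]
  · rw [hq, eM, Function.update_of_ne (by omega), Function.update_self]
  · rw [hq, eM, Function.update_self]
  · exact key c (by omega) (by omega) (by omega) (by omega)
  · exact key c (by omega) (by omega) (by omega) (by omega)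

/-- The registers after the first half of `edgeBody`, in the form of a rule for the program `P` that
follows. -/
theorem runsIn_readCode_computePoints {m : ℕ} {w : EdgeCode} {s : State} (hc : Constants s)
    (h6 : s.reg 6 = 4 * m) (hI : InputAt s.mem m [w]) {B : ℕ} {P : Program} {Q : State → Prop}
    (h : ∀ s' : State, s'.mem = s.mem → s'.reg 6 = 4 * (m + 1 : ℕ) → s'.reg 0 = s.reg 0 - 1 →
      s'.reg 4 = s.reg 4 → s'.reg 30 = s.reg 30 → Constants s' →
      s'.reg 14 = 4 * m → s'.reg 15 = 4 * m + 1 →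
      s'.reg 10 = w.origin 0 → s'.reg 11 = w.origin 1 → s'.reg 12 = w.origin 2 →
      s'.reg 21 = (w.origin + unit w.direction) 0 → s'.reg 22 = (w.origin + unit w.direction) 1 →
      s'.reg 23 = (w.origin + unit w.direction) 2 →
      s'.reg 24 = (w.origin - unit (w.direction + 1)) 0 →
      s'.reg 25 = (w.origin - unit (w.direction + 1)) 1 →
      s'.reg 26 = (w.origin - unit (w.direction + 1)) 2 →
      s'.reg 27 = (w.origin - unit (w.direction + 2)) 0 →
      s'.reg 28 = (w.origin - unit (w.direction + 2)) 1 →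
      s'.reg 29 = (w.origin - unit (w.direction + 2)) 2 →
      RunsIn P s' B Q) :
    RunsIn (.seq readCode (.seq computePoints P)) s
      (readCode.cost + (computePoints.cost + B)) Q := by
  obtain ⟨⟨i0, i1, i2, i3⟩, -⟩ := hI
  obtain ⟨p, i⟩ := w
  generalize hq : 4 * (m : ℤ) = q at *
  set s₁ := readCode.eval s with hs₁
  -- the direction as a number, so that the branches of `readCode` are decided in each of three cases
  have h13 : ∀ j : ℕ, s.mem (q + 1 + 1 + 1) = j → j < 3 →
      s₁.reg 16 = (if j = 0 then 1 else 0) ∧ s₁.reg 17 = (if j = 1 then 1 else 0) ∧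
      s₁.reg 18 = (if j = 2 then 1 else 0) ∧ s₁.reg 10 = p 0 ∧ s₁.reg 11 = p 1 ∧
      s₁.reg 12 = p 2 ∧ s₁.reg 14 = q ∧ s₁.reg 15 = q + 1 ∧ s₁.reg 6 = q + 1 + 1 + 1 + 1 ∧
      s₁.mem = s.mem := by
    intro j hj hj3
    rw [hs₁]
    clear hs₁ s₁ i3
    interval_cases j <;> refine ⟨?_, ?_, ?_, ?_, ?_, ?_, ?_, ?_, ?_, ?_⟩ <;>
    simp [readCode, block, Program.eval, State.setReg, hc.one, hc.four, h6, i0, i1, i2, hj]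
    all_goals omega
  obtain ⟨e16, e17, e18, e10, e11, e12, e14, e15, e6, eM⟩ := h13 i i3 i.2
  refine RunsIn.seq ((RunsIn.eval (P := readCode) (by simp [readCode, block, LoopFree]) s
    (Q := fun s' => s' = s₁) rfl).frame.mono le_rfl ?_)
  rintro _ ⟨rfl, hf⟩
  have hc₁ : Constants s₁ := hc.congr hf (by decide)
  refine RunsIn.seq ((RunsIn.eval (P := computePoints) (by simp [computePoints, block, LoopFree]) s₁
    (Q := fun s' => s' = computePoints.eval s₁) rfl).frame.mono le_rfl ?_)
  rintro _ ⟨rfl, hf'⟩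
  have f0 := hf 0 (by decide)
  have f4 := hf 4 (by decide)
  have f30 := hf 30 (by decide)
  refine h _ ?_ ?_ ?_ ((hf' 4 (by decide)).trans f4) ((hf' 30 (by decide)).trans f30)
    (hc₁.congr hf' (by decide)) ((hf' 14 (by decide)).trans e14) ((hf' 15 (by decide)).trans e15)
    ((hf' 10 (by decide)).trans e10) ((hf' 11 (by decide)).trans e11)
    ((hf' 12 (by decide)).trans e12) ?_ ?_ ?_ ?_ ?_ ?_ ?_ ?_ ?_
  · exact eM
  · rw [hf' 6 (by decide), e6]; push_cast; omega
  · simp [computePoints, block, Program.eval, State.setReg, hc₁.one, f0]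
  all_goals
    simp [computePoints, block, Program.eval, State.setReg, e10, e11, e12, e16, e17, e18]
    rcases eq_zero_one_two i with rfl | rfl | rfl <;> simp

theorem runsIn_edgeBody {m : ℕ} {w : EdgeCode} {l : List EdgeCode} {L : List Site} {s : State}
    (hc : Constants s) (h6 : s.reg 6 = 4 * m) (hI : InputAt s.mem m (w :: l))
    (h4 : s.reg 4 = 4 * L.length) (hS : Stored s.mem L) :
    RunsIn edgeBody s (readCode.cost + (computePoints.cost + 40)) fun s' =>
      Constants s' ∧ s'.reg 6 = 4 * (m + 1 : ℕ) ∧ s'.reg 0 = s.reg 0 - 1 ∧ s'.reg 30 = s.reg 30 ∧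
      InputAt s'.mem (m + 1) l ∧ s'.reg 4 = 4 * (edgeSites m w ++ L).length ∧
      Stored s'.mem (edgeSites m w ++ L) := by
  refine runsIn_readCode_computePoints hc h6 ⟨hI.1, trivial⟩ ?_
  intro s₁ eM e6 e0 e4 e30 hc₁ e14 e15 e10 e11 e12 e21 e22 e23 e24 e25 e26 e27 e28 e29
  -- `emit` changes only the registers `4` and `20`
  have hconst : ∀ {s s' : State}, Constants s → (∀ r, r ∉ [4, 20] → s'.reg r = s.reg r) →
      Constants s' := fun hc hf => ⟨(hf 1 (by decide)).trans hc.one,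
        (hf 2 (by decide)).trans hc.four, (hf 3 (by decide)).trans hc.zero⟩
  refine RunsIn.seq (B := 10) (B' := 30) ((runsIn_emit (b := ⟨w.origin, 4 * m⟩) (by decide) hc₁
    e10 e11 e12 e14 (e4.trans h4) (eM ▸ hS)).mono le_rfl ?_)
  rintro s₂ ⟨⟨e4₂, hS₂, eM₂⟩, f₂⟩
  refine RunsIn.seq (B := 10) (B' := 20) ((runsIn_emit (b := ⟨w.origin + unit w.direction, 4 * m⟩)
    (by decide) (hconst hc₁ f₂) ((f₂ _ (by decide)).trans e21) ((f₂ _ (by decide)).trans e22)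
    ((f₂ _ (by decide)).trans e23) ((f₂ _ (by decide)).trans e14) e4₂ hS₂).mono le_rfl ?_)
  rintro s₃ ⟨⟨e4₃, hS₃, eM₃⟩, f₃⟩
  have f₃ : ∀ r, r ∉ [4, 20] → s₃.reg r = s₁.reg r := fun r hr => (f₃ r hr).trans (f₂ r hr)
  refine RunsIn.seq (B := 10) (B' := 10) ((runsIn_emit
    (b := ⟨w.origin - unit (w.direction + 1), 4 * m + 1⟩)
    (by decide) (hconst hc₁ f₃) ((f₃ _ (by decide)).trans e24) ((f₃ _ (by decide)).trans e25)
    ((f₃ _ (by decide)).trans e26) ((f₃ _ (by decide)).trans e15) e4₃ hS₃).mono le_rfl ?_)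
  rintro s₄ ⟨⟨e4₄, hS₄, eM₄⟩, f₄⟩
  have f₄ : ∀ r, r ∉ [4, 20] → s₄.reg r = s₁.reg r := fun r hr => (f₄ r hr).trans (f₃ r hr)
  refine (runsIn_emit
    (b := ⟨w.origin - unit (w.direction + 2), 4 * m + 1⟩)
    (by decide) (hconst hc₁ f₄) ((f₄ _ (by decide)).trans e27) ((f₄ _ (by decide)).trans e28)
    ((f₄ _ (by decide)).trans e29) ((f₄ _ (by decide)).trans e15) e4₄ hS₄).mono le_rfl ?_
  rintro s₅ ⟨⟨e4₅, hS₅, eM₅⟩, f₅⟩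
  have f₅ : ∀ r, r ∉ [4, 20] → s₅.reg r = s₁.reg r := fun r hr => (f₅ r hr).trans (f₄ r hr)
  refine ⟨hconst hc₁ f₅, (f₅ _ (by decide)).trans e6, (f₅ _ (by decide)).trans e0,
    (f₅ _ (by decide)).trans e30, hI.2.congr fun a ha => ?_, e4₅, hS₅⟩
  rw [eM₅ a ha, eM₄ a ha, eM₃ a ha, eM₂ a ha, eM]

theorem runsIn_loop_edgeBody {m : ℕ} {l : List EdgeCode} {L : List Site} {s : State}
    (hc : Constants s) (h0 : s.reg 0 = l.length) (h6 : s.reg 6 = 4 * m) (hI : InputAt s.mem m l)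
    (h4 : s.reg 4 = 4 * L.length) (hS : Stored s.mem L) :
    RunsIn (.loop 0 edgeBody) s ((readCode.cost + (computePoints.cost + 40) + 1) * l.length + 1)
      fun s' => Constants s' ∧ s'.reg 30 = s.reg 30 ∧ s'.reg 4 = 4 * (sites m l L).length ∧
        Stored s'.mem (sites m l L) := by
  induction l generalizing m L s with
  | nil => exact RunsIn.loop_done (by simp [h0]) ⟨hc, rfl, h4, hS⟩
  | cons w l ih =>
    simp only [List.length_cons] at h0 ⊢
    push_cast at h0
    set B := readCode.cost + (computePoints.cost + 40) with hB
    refine (RunsIn.loop_step (by omega)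
      ((runsIn_edgeBody hc h6 hI h4 hS).mono le_rfl ?_)).mono
        (B := B + ((B + 1) * l.length + 1) + 1) (by rw [Nat.mul_succ]; omega) fun _ h => h
    rintro s' ⟨hc', e6, e0, e30, hI', e4, hS'⟩
    refine (ih hc' (by omega) e6 hI' e4 hS').mono le_rfl fun s'' ⟨hc'', e30', h⟩ => ?_
    exact ⟨hc'', e30'.trans e30, h⟩

theorem solver_cost_le (a b c n : ℕ) :
    3 + (a * n + 1 + (1 + ((5 + ((b + (c * (4 * n) + 1) + 1) * (4 * n) + 1)) * (4 * (4 * n)) + 1 +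
      3))) ≤ (a + 64 * b + 256 * c + 300) * (n ^ 3 + 1) := by
  have h1 : n ≤ n ^ 3 := Nat.le_self_pow (by decide) n
  have h2 : n ^ 2 ≤ n ^ 3 := by
    rcases Nat.eq_zero_or_pos n with rfl | h
    · decide
    · exact Nat.pow_le_pow_right h (by decide)
  have ha := Nat.mul_le_mul_left a h1
  have hb := Nat.mul_le_mul_left b h2
  ring_nf at ha hb h1 h2 ⊢
  linarith [Nat.zero_le a, Nat.zero_le b, Nat.zero_le c]

/-- The program computes the flag of the Bellman–Ford method for the constraints of the puzzle. The
values at the beginning are those that happen to be in the memory. -/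
theorem runsIn_solver : ∃ K : ℕ, ∀ l : List EdgeCode,
    RunsIn solver (inputState l) (K * (l.length ^ 3 + 1)) fun s => ∃ M : ℤ → ℤ,
      s.reg 0 = if 0 < ((bellmanFordRound (siteArcs (sites 0 l [])))^[16 * l.length] (M, 0)).2
        then 0 else 1 := by
  refine ⟨readCode.cost + (computePoints.cost + 40) + 1 + 64 * loadSource.cost +
    256 * (relaxBody.cost + 1) + 300, fun l => ?_⟩
  have hlen : (sites 0 l []).length = 4 * l.length := length_sites 0 l []
  have hL : ∀ b ∈ sites 0 l [], 0 ≤ b.addr := fun b hb => addr_nonneg_of_mem_sites hb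
  set init : Program := block [const 1 1, const 2 4] with hinit
  set s₁ := init.eval (inputState l) with hs₁
  have hc₁ : Constants s₁ := by
    refine ⟨?_, ?_, ?_⟩ <;> simp [hs₁, hinit, block, Program.eval, State.setReg, inputState]
  have e0 : s₁.reg 0 = l.length := by
    simp [hs₁, hinit, block, Program.eval, State.setReg, inputState]
  have e4 : s₁.reg 4 = 4 * ([] : List Site).length := by
    simp [hs₁, hinit, block, Program.eval, State.setReg, inputState]
  have e6 : s₁.reg 6 = 4 * (0 : ℕ) := by
    simp [hs₁, hinit, block, Program.eval, State.setReg, inputState]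
  have e30 : s₁.reg 30 = 0 := by
    simp [hs₁, hinit, block, Program.eval, State.setReg, inputState]
  have eM : s₁.mem = (inputState l).mem := rfl
  refine (RunsIn.seq (RunsIn.eval (P := init) (by simp [hinit, block, LoopFree]) (inputState l)
    (RunsIn.seq ((runsIn_loop_edgeBody hc₁ e0 e6 (eM ▸ inputAt_inputState l) e4 trivial).mono
      le_rfl ?_)))).mono (solver_cost_le _ _ _ l.length) fun _ h => h
  rintro s₂ ⟨hc₂, e30₂, e4₂, hS₂⟩
  refine RunsIn.seq (RunsIn.eval (P := .add 5 4 3) trivial s₂ (RunsIn.seq (B' := 3) ?_))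
  set s₃ := (Program.add 5 4 3).eval s₂ with hs₃
  have hc₃ : Constants s₃ := by
    refine ⟨?_, ?_, ?_⟩ <;> simp [hs₃, Program.eval, State.setReg, hc₂.one, hc₂.four, hc₂.zero]
  have e4₃ : s₃.reg 4 = 4 * (sites 0 l []).length := by
    simp [hs₃, Program.eval, State.setReg, e4₂]
  have e5₃ : s₃.reg 5 = (4 * (4 * l.length) : ℕ) := by
    simp [hs₃, Program.eval, State.setReg, e4₂, hc₂.zero, hlen]
  have e30₃ : s₃.reg 30 = 0 := by
    simp [hs₃, Program.eval, State.setReg, e30₂, e30]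
  refine (runsIn_loop_roundBody hL _ hc₃ e4₃ e5₃ hS₂).mono (by rw [hlen]) fun s₄ hs₄ => ?_
  refine RunsIn.eval (P := .branch 30 (.const 0 0) (.const 0 1)) ⟨trivial, trivial⟩ s₄ ⟨s₃.mem, ?_⟩
  have hflag := congrArg Prod.snd hs₄
  rw [e30₃, show 4 * (4 * l.length) = 16 * l.length by ring] at hflag
  rw [← hflag]
  simp only [Program.eval]
  split_ifs <;> simp [State.setReg]

end Calissons

/-- One program of the unit-cost random access machine decides, for every finite set `X` of edges of
the infinite triangular grid, whether the calissons puzzle with the edges `X` has a solution (answer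
`1` or `0` in register `0`), within `O(|X|^3)` steps. -/
theorem theorem3 :
    ∃ (P : Calissons.Program) (K : ℕ),
      ∀ X : Finset (Sym2 Calissons.Vertex), (X : Set (Sym2 Calissons.Vertex)) ⊆ Calissons.gridEdges →
        ∀ l : List Calissons.EdgeCode, Calissons.Enumerates l X →
          ∃ (t : ℕ) (s : Calissons.State),
            Calissons.Exec P (Calissons.inputState l) t s ∧
            t ≤ K * (X.card ^ 3 + 1) ∧
            (Calissons.HasSolution X → s.reg 0 = 1) ∧
            (¬ Calissons.HasSolution X → s.reg 0 = 0) := by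
  classical
  obtain ⟨K, hK⟩ := Calissons.runsIn_solver
  refine ⟨Calissons.Program.solver, K, fun X _ l hl => ?_⟩
  obtain ⟨t, s, he, ht, M, hs⟩ := hK l
  have hcard : X.card = l.length := by
    have : X = (l.map Calissons.EdgeCode.edge).toFinset := by
      ext e
      rw [List.mem_toFinset, hl.2]
    rw [this, List.toFinset_card_of_nodup hl.1, List.length_map]
  refine ⟨t, s, he, hcard ▸ ht, ?_⟩
  rw [Calissons.hasSolution_iff hl, Calissons.exists_height_iff, hs]
  rcases Nat.eq_zero_or_pos l.length with h | h
  -- without edges there is no round, and the flag still has its initial value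
  · obtain rfl := List.eq_nil_of_length_eq_zero h
    simp [Calissons.siteArcs, Calissons.sites]
  · have hflag := Calissons.bellmanFord_flag (A := Calissons.siteArcs (Calissons.sites 0 l []))
      (S := ((Calissons.sites 0 l []).map Calissons.Site.addr).toFinset) (k := 16 * l.length) (by
        intro c hc
        obtain ⟨a, ha, b, -, rfl⟩ := Calissons.mem_siteArcs.1 hc
        exact List.mem_toFinset.2 (List.mem_map_of_mem ha)) (by
        refine (List.toFinset_card_le _).trans_lt ?_
        rw [List.length_map, Calissons.length_sites]
        simp only [List.length_nil]
        omega) (M, 0)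
    exact ⟨fun hu => by rw [hflag.1 hu]; rfl, fun hu => by rw [hflag.2 hu]; rfl⟩
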